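/- \textbf{Setting.} Let $M$ be a Riemannian $3$-manifold, $H\in\mathbb R$ a constant, and $S$ a Killing field on $M$. The statement is local: let $U\subset M$ be the domain of a chart with star-shaped image, with either of its two orientations, and let $\mathrm{vol}_M$ be the Riemannian volume form on $U$. Let $\mathcal C=\{(x,e): x\in U,\ e\in T_xM,\ |e|=1\}$ be the unit tangent bundle over $U$, with contact form $\theta^0_{(x,e)}(u,\xi)=\langle e,u\rangle_x$. Put $\Lambda_0=e\lrcorner\mathrm{vol}_M$ and, for a smooth vector field $\Xi$ on $U$ with $\operatorname{div}\Xi=1$, $\Lambda'=\Xi\lrcorner \mathrm{vol}_M$ and $\Lambda=\Lambda_0+2H\Lambda'$, the lagrangian of constant mean curvature $H$ surfaces. In orthonormal frames $(e_0=e,e_1,e_2)$, with dual forms $\theta^i$ and connection forms $\omega^i_j$ (where $\nabla e_j=\sum_i\omega^i_j e_i$), let $\Psi=-\omega^2_0\wedge\theta^1-\omega^0_1\wedge\theta^2+2H\Lambda_0$. Let $\mathcal I$ be the ideal of $\Omega^*(\mathcal C)$ generated by $\theta^0,d\theta^0$ (contact ideal) and $\mathcal E$ the differential ideal generated by $\theta^0,d\theta^0,\Psi$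 (Euler--Lagrange system). The extension of $S$ to $\mathcal C$, also denoted $S$, is the vector field induced by the differential of the flow of $S$; in coordinates it is $(S(x),DS_x e)$ at $(x,e)$. A vector field $X$ on $\mathcal C$ is a divergence symmetry if $\mathcal L_X\Lambda\equiv d\varphi \bmod \mathcal E$ for some $\varphi\in\Omega^1(\mathcal C)$. Conservation laws are $1$-forms $\mu$ on $\mathcal C$ with $d\mu\in\mathcal E$; two $1$-forms on $\mathcal C$ are in the same class when they differ by $dh+a\theta^0$ with smooth functions $h,a$ on $\mathcal C$, that is, by an exact form modulo $\mathcal E$. A potential vector of $S$ is a smooth vector field $F$ on $U$ with $\operatorname{curl}F=(*dF^\flat)^\sharp=S$. \textbf{Theorem.} For every such $U$ and $\Xi$: (1) The extension of $S$ to $\mathcal C$ is a divergence symmetry, and $S$ has a potential vector on $U$. (2) For every potential vector $F$ of $S$, the $1$-form $\varphi_F=2H\,(S\lrcorner\Lambda'+F^\flat)$ satisfies $\mathcal L_S\Lambda\equiv d\varphi_F$ modulo $\mathcal I$ (hence modulo $\mathcal E$), and the Noether form of $S$ is $$\mu_S=S\lrcorner\Lambda_0-2HF^\flat .$$ That is,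 $S\lrcorner\Lambda_0-2HF^\flat$ is a conservation law, and for every $\varphi\in\Omega^1(\mathcal C)$ with $\mathcal L_S\Lambda\equiv d\varphi \bmod \mathcal I$ the form $S\lrcorner\Lambda-\varphi$ is in the class of $S\lrcorner\Lambda_0-2HF^\flat$. (3) The class does not depend on the choice of the potential vector: if $F,\widetilde F$ are potential vectors of $S$, then $S\lrcorner\Lambda_0-2HF^\flat$ and $S\lrcorner\Lambda_0-2H\widetilde F^\flat$ are in the same class. -/

import Mathlib

open scoped Manifold ContDiff

namespace CMCNoether

noncomputable section

/-- The model space of a 3-manifold, in which coordinates take their values. -/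
abbrev E3 : Type := EuclideanSpace ℝ (Fin 3)

/-- Coordinates `(x, e)` on the tangent bundle over a coordinate domain: `x` is the base point and
`e` a tangent vector at `x`, written in the coordinate frame. A tangent vector to the tangent bundle
is again a pair `(u, ξ)`. -/
abbrev TM : Type := E3 × E3

/-- The `i`-th coordinate vector field. -/
def frame (i : Fin 3) : E3 := EuclideanSpace.single i 1

/-! ### Riemannian geometry of a coordinate domain

`G x u v` is the scalar product `⟨u, v⟩_x`; the sign `ε` tells whether the coordinates are positively
or negatively oriented. -/

/-- The matrix `g_ij(x)` of the metric. -/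
def gram (G : E3 → E3 →L[ℝ] E3 →L[ℝ] ℝ) (x : E3) : Matrix (Fin 3) (Fin 3) ℝ :=
  Matrix.of fun i j => G x (frame i) (frame j)

/-- The determinant of three vectors of `E3`, as a continuous alternating form. -/
def detForm : E3 [⋀^Fin 3]→L[ℝ] ℝ :=
  { (EuclideanSpace.basisFun (Fin 3) ℝ).toBasis.det with
    cont := by
      change Continuous fun v : Fin 3 → E3 =>
        (EuclideanSpace.basisFun (Fin 3) ℝ).toBasis.det v
      simp only [Module.Basis.det_apply]
      refine Continuous.matrix_det (continuous_matrix fun i j => ?_)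
      simp only [Module.Basis.toMatrix_apply, OrthonormalBasis.coe_toBasis_repr_apply,
        EuclideanSpace.basisFun_repr]
      fun_prop }

/-- The Riemannian volume form `vol_M = ε √(det g) dx⁰ ∧ dx¹ ∧ dx²`. -/
def volForm (G : E3 → E3 →L[ℝ] E3 →L[ℝ] ℝ) (ε : ℤˣ) (x : E3) : E3 [⋀^Fin 3]→L[ℝ] ℝ :=
  (((ε : ℤ) : ℝ) * Real.sqrt (gram G x).det) • detForm

/-- The divergence `(1 / √(det g)) ∑ ∂_i (√(det g) X^i)` of a vector field. -/
def divergence (G : E3 → E3 →L[ℝ] E3 →L[ℝ] ℝ) (X : E3 → E3) (x : E3) : ℝ :=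
  (Real.sqrt (gram G x).det)⁻¹ *
    ∑ i : Fin 3, fderiv ℝ (fun y => Real.sqrt (gram G y).det * X y i) x (frame i)

/-- The `1`-form `F^♭ = ⟨F, ·⟩`. -/
def flatForm (G : E3 → E3 →L[ℝ] E3 →L[ℝ] ℝ) (F : E3 → E3) (x : E3) : E3 [⋀^Fin 1]→L[ℝ] ℝ :=
  ContinuousAlternatingMap.ofSubsingleton ℝ E3 ℝ (0 : Fin 1) (G x (F x))

/-- The curl `rot_M F = (* d F^♭)^♯`, with components
`(rot_M F)^i = (ε / √(det g)) (∂_j F_k - ∂_k F_j)` for `(i, j, k)` a cyclic permutation of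
`(0, 1, 2)`. -/
def curl (G : E3 → E3 →L[ℝ] E3 →L[ℝ] ℝ) (ε : ℤˣ) (F : E3 → E3) (x : E3) : E3 :=
  (((ε : ℤ) : ℝ) * (Real.sqrt (gram G x).det)⁻¹) •
    !₂[extDeriv (flatForm G F) x ![frame 1, frame 2],
       extDeriv (flatForm G F) x ![frame 2, frame 0],
       extDeriv (flatForm G F) x ![frame 0, frame 1]]

/-- The Christoffel term `Γ_x(u, v)` of the Levi-Civita connection, so that
`∇_u V = DV(u) + Γ(u, V)`. -/
def christoffel (G : E3 → E3 →L[ℝ] E3 →L[ℝ] ℝ) (x u v : E3) : E3 :=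
  WithLp.toLp 2 (Matrix.mulVec (gram G x)⁻¹ fun l =>
    (fderiv ℝ G x u v (frame l) + fderiv ℝ G x v u (frame l) - fderiv ℝ G x (frame l) u v) / 2)

/-- The Killing equation `L_S g = 0` on the set `U`. -/
def KillingEquationOn (U : Set E3) (G : E3 → E3 →L[ℝ] E3 →L[ℝ] ℝ) (S : E3 → E3) : Prop :=
  ∀ x ∈ U, ∀ u v : E3,
    fderiv ℝ G x (S x) u v + G x (fderiv ℝ S x u) v + G x u (fderiv ℝ S x v) = 0

/-- `Ξ` is a volume field on `U`: a smooth vector field with divergence `1`. -/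
def IsVolumeField (U : Set E3) (G : E3 → E3 →L[ℝ] E3 →L[ℝ] ℝ) (Ξ : E3 → E3) : Prop :=
  ContDiffOn ℝ ∞ Ξ U ∧ ∀ x ∈ U, divergence G Ξ x = 1

/-- `F` is a potential vector of `S` on `U`: a smooth vector field with `rot_M F = S`. -/
def IsPotentialVector (U : Set E3) (G : E3 → E3 →L[ℝ] E3 →L[ℝ] ℝ) (ε : ℤˣ) (S F : E3 → E3) : Prop :=
  ContDiffOn ℝ ∞ F U ∧ ∀ x ∈ U, curl G ε F x = S x

/-! ### Coordinate expressions on a Riemannian 3-manifold -/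

section Manifold

variable {M : Type*} [TopologicalSpace M] [ChartedSpace (EuclideanSpace ℝ (Fin 3)) M]
  [IsManifold (𝓡 3) ∞ M]

/-- A smooth Riemannian metric on `M`. -/
abbrev RiemMetric (M : Type*) [TopologicalSpace M] [ChartedSpace (EuclideanSpace ℝ (Fin 3)) M]
    [IsManifold (𝓡 3) ∞ M] :=
  Bundle.ContMDiffRiemannianMetric (𝓡 3) ∞ E3 (fun x : M => TangentSpace (𝓡 3) x)

/-- The differential of the inverse of a chart, from coordinates to tangent vectors of `M`. -/
def chartDeriv (c : OpenPartialHomeomorph M E3) (y : E3) :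
    E3 →L[ℝ] TangentSpace (𝓡 3) (c.symm y) :=
  mfderiv (𝓡 3) (𝓡 3) c.symm y

/-- The coordinate expression of the metric in the chart `c`. -/
def coordMetric (g : RiemMetric M) (c : OpenPartialHomeomorph M E3) (y : E3) : E3 →L[ℝ] E3 →L[ℝ] ℝ :=
  (ContinuousLinearMap.precomp ℝ (chartDeriv c y)).comp
    ((g.inner (c.symm y)).comp (chartDeriv c y))

/-- The coordinate expression of a vector field in the chart `c`. -/
def coordField (S : (x : M) → TangentSpace (𝓡 3) x) (c : OpenPartialHomeomorph M E3) (y : E3) : E3 :=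
  VectorField.mpullback (𝓡 3) (𝓡 3) c.symm S y

/-- `S` is a Killing field: a smooth vector field that satisfies the Killing equation in all
coordinate systems. -/
def IsKilling (g : RiemMetric M) (S : (x : M) → TangentSpace (𝓡 3) x) : Prop :=
  ContMDiff (𝓡 3) (𝓡 3).tangent ∞ (fun x => (⟨x, S x⟩ : TangentBundle (𝓡 3) M)) ∧
    ∀ c ∈ IsManifold.maximalAtlas (𝓡 3) ∞ M,
      KillingEquationOn c.target (coordMetric g c) (coordField S c)

end Manifold

/-! ### The unit tangent bundle and its differential forms

The contact manifold `𝒞` over `U` is a closed hypersurface of `U × ℝ³`, so every smooth function or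
form on `𝒞` is the restriction of one on `U × ℝ³`. We write functions and forms on `𝒞` as smooth ones
on `U × ℝ³`, and compare forms only at points of `𝒞` and on vectors tangent to `𝒞`. The exterior
derivative, and the Lie derivative and contraction along fields tangent to `𝒞`, are compatible
with restriction to `𝒞`. -/

/-- Fields of alternating `n`-forms on the coordinate space of the tangent bundle. -/
abbrev Form (n : ℕ) : Type := TM → TM [⋀^Fin n]→L[ℝ] ℝ

/-- Smoothness of functions, forms, fields over `U`. -/
def SmoothOver {V : Type*} [NormedAddCommGroup V] [NormedSpace ℝ V] (U : Set E3) (f : TM → V) : Prop :=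
  ContDiffOn ℝ ∞ f (U ×ˢ Set.univ)

/-- The unit tangent bundle `𝒞 = {(x, e) : x ∈ U, ⟨e, e⟩_x = 1}`. -/
def unitBundle (U : Set E3) (G : E3 → E3 →L[ℝ] E3 →L[ℝ] ℝ) : Set TM :=
  {p | p.1 ∈ U ∧ G p.1 p.2 p.2 = 1}

/-- The tangent space of `𝒞` at `p`. -/
def unitTangent (G : E3 → E3 →L[ℝ] E3 →L[ℝ] ℝ) (p : TM) : Set TM :=
  {w | fderiv ℝ (fun q : TM => G q.1 q.2 q.2) p w = 0}

/-- `X` is a smooth vector field on `𝒞`. -/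
def IsFieldOnUnitBundle (U : Set E3) (G : E3 → E3 →L[ℝ] E3 →L[ℝ] ℝ) (X : TM → TM) : Prop :=
  SmoothOver U X ∧ ∀ p ∈ unitBundle U G, X p ∈ unitTangent G p

/-- The extension of a vector field `S` to the tangent bundle, with value `(S(x), DS(x) e)` at
`(x, e)`: if `Φ_t` is the flow of `S`, it is the derivative at `t = 0` of
`(Φ_t(x), DΦ_t(x) e)`. -/
def extension (S : E3 → E3) (p : TM) : TM := (S p.1, fderiv ℝ S p.1 p.2)

/-- The lift of a form from the base. -/
def liftForm {n : ℕ} (η : E3 → E3 [⋀^Fin n]→L[ℝ] ℝ) : Form n := fun p =>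
  (η p.1).compContinuousLinearMap (ContinuousLinearMap.fst ℝ E3 E3)

/-- The contraction `X ⌟ η`. -/
def contract {n : ℕ} (X : TM → TM) (η : Form (n + 1)) : Form n := fun p => (η p).curryLeft (X p)

/-- The Lie derivative `L_X η = d(X ⌟ η) + X ⌟ dη`. -/
def lieDeriv {n : ℕ} (X : TM → TM) (η : Form (n + 1)) : Form (n + 1) :=
  extDeriv (contract X η) + contract X (extDeriv η)

/-- The differential of a function. -/
def differential (h : TM → ℝ) : Form 1 := fun p =>
  ContinuousAlternatingMap.ofSubsingleton ℝ TM ℝ (0 : Fin 1) (fderiv ℝ h p)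

/-- The contact form `θ⁰_(x,e)(u, ξ) = ⟨e, u⟩_x`. -/
def contactForm (G : E3 → E3 →L[ℝ] E3 →L[ℝ] ℝ) : Form 1 := fun p =>
  ContinuousAlternatingMap.ofSubsingleton ℝ TM ℝ (0 : Fin 1)
    ((G p.1 p.2).comp (ContinuousLinearMap.fst ℝ E3 E3))

/-- The area lagrangian `Λ₀ = e ⌟ vol_M`. -/
def lagrangian₀ (G : E3 → E3 →L[ℝ] E3 →L[ℝ] ℝ) (ε : ℤˣ) : Form 2 := fun p =>
  ((volForm G ε p.1).curryLeft p.2).compContinuousLinearMap (ContinuousLinearMap.fst ℝ E3 E3)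

/-- The volume lagrangian `Λ' = Ξ ⌟ vol_M`. -/
def lagrangian' (G : E3 → E3 →L[ℝ] E3 →L[ℝ] ℝ) (ε : ℤˣ) (Ξ : E3 → E3) : Form 2 :=
  liftForm fun x => (volForm G ε x).curryLeft (Ξ x)

/-- The lagrangian `Λ = Λ₀ + 2HΛ'` of CMC-`H` immersions. -/
def lagrangian (G : E3 → E3 →L[ℝ] E3 →L[ℝ] ℝ) (ε : ℤˣ) (H : ℝ) (Ξ : E3 → E3) : Form 2 :=
  lagrangian₀ G ε + (2 * H) • lagrangian' G ε Ξ

/-- The vertical part `∇e (u, ξ) = ξ + Γ_x(u, e)` of a tangent vector `(u, ξ)` at `(x, e)`. In an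
orthonormal frame `(e₀ = e, e₁, e₂)` the connection forms are `ω²₀ = ⟨∇e, e₂⟩`,
`ω⁰₁ = -⟨∇e, e₁⟩`. -/
def verticalPart (G : E3 → E3 →L[ℝ] E3 →L[ℝ] ℝ) (p w : TM) : E3 :=
  w.2 + christoffel G p.1 w.1 p.2

/-- The values of the Euler-Lagrange operator `Ψ₀ = -ω²₀ ∧ θ¹ - ω⁰₁ ∧ θ²` of the area functional:
for a positive orthonormal frame `(e₀ = e, e₁, e₂)` one has
`vol_M(e, a, b) = (θ¹ ∧ θ²)(a, b)`, hence
`Ψ₀(w, w') = vol_M(e, ∇e(w), u') + vol_M(e, u, ∇e(w'))`. -/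
def eulerLagrange₀ (G : E3 → E3 →L[ℝ] E3 →L[ℝ] ℝ) (ε : ℤˣ) (p w w' : TM) : ℝ :=
  volForm G ε p.1 ![p.2, verticalPart G p w, w'.1] +
    volForm G ε p.1 ![p.2, w.1, verticalPart G p w']

/-- The values of the Euler-Lagrange operator `Ψ = Ψ₀ + 2HΛ₀`. -/
def eulerLagrange (G : E3 → E3 →L[ℝ] E3 →L[ℝ] ℝ) (ε : ℤˣ) (H : ℝ) (p w w' : TM) : ℝ :=
  eulerLagrange₀ G ε p w w' + 2 * H * lagrangian₀ G ε p ![w, w']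

/-- The `2`-form `η` on `𝒞` belongs to the contact ideal generated by `θ⁰` and `dθ⁰`:
`η = θ⁰ ∧ α + a dθ⁰` on `𝒞`. -/
def InContactIdeal₂ (U : Set E3) (G : E3 → E3 →L[ℝ] E3 →L[ℝ] ℝ) (η : Form 2) : Prop :=
  ∃ (α : Form 1) (a : TM → ℝ), SmoothOver U α ∧ SmoothOver U a ∧
    ∀ p ∈ unitBundle U G, ∀ w ∈ unitTangent G p, ∀ w' ∈ unitTangent G p,
      η p ![w, w'] =
        (contactForm G p ![w] * α p ![w'] - contactForm G p ![w'] * α p ![w])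
          + a p * extDeriv (contactForm G) p ![w, w']

/-- The `2`-form `η` on `𝒞` belongs to the Euler-Lagrange system `ℰ`, the differential ideal generated
by `θ⁰`, `dθ⁰` and `Ψ`: `η = θ⁰ ∧ α + a dθ⁰ + b Ψ` on `𝒞`. -/
def InEulerLagrangeSystem₂ (U : Set E3) (G : E3 → E3 →L[ℝ] E3 →L[ℝ] ℝ) (ε : ℤˣ) (H : ℝ)
    (η : Form 2) : Prop :=
  ∃ (α : Form 1) (a b : TM → ℝ), SmoothOver U α ∧ SmoothOver U a ∧ SmoothOver U b ∧
    ∀ p ∈ unitBundle U G, ∀ w ∈ unitTangent G p, ∀ w' ∈ unitTangent G p,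
      η p ![w, w'] =
        (contactForm G p ![w] * α p ![w'] - contactForm G p ![w'] * α p ![w])
          + a p * extDeriv (contactForm G) p ![w, w'] + b p * eulerLagrange G ε H p w w'

/-- The `1`-form `η` on `𝒞` belongs to the Euler-Lagrange system `ℰ`, whose elements of degree `1` are
the multiples of `θ⁰` (as for the contact ideal). -/
def InEulerLagrangeSystem₁ (U : Set E3) (G : E3 → E3 →L[ℝ] E3 →L[ℝ] ℝ) (η : Form 1) : Prop :=
  ∃ a : TM → ℝ, SmoothOver U a ∧
    ∀ p ∈ unitBundle U G, ∀ w ∈ unitTangent G p, η p ![w] = a p * contactForm G p ![w]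

/-! ### Divergence symmetries and Noether forms -/

/-- `X` is a divergence symmetry of the variational problem with lagrangian `Λ`: a vector field on
`𝒞` with `L_X Λ ≡ dφ mod ℰ` for some `1`-form `φ` on `𝒞`. -/
def IsDivergenceSymmetry (U : Set E3) (G : E3 → E3 →L[ℝ] E3 →L[ℝ] ℝ) (ε : ℤˣ) (H : ℝ)
    (Ξ : E3 → E3) (X : TM → TM) : Prop :=
  IsFieldOnUnitBundle U G X ∧ ∃ φ : Form 1, SmoothOver U φ ∧
    InEulerLagrangeSystem₂ U G ε H (lieDeriv X (lagrangian G ε H Ξ) - extDeriv φ)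

/-- The `1`-form `φ` on `𝒞` compensates the variation of `Λ` along `X`: `L_X Λ ≡ dφ` modulo the contact
ideal, hence also modulo `ℰ`. -/
def IsCompensator (U : Set E3) (G : E3 → E3 →L[ℝ] E3 →L[ℝ] ℝ) (ε : ℤˣ) (H : ℝ)
    (Ξ : E3 → E3) (X : TM → TM) (φ : Form 1) : Prop :=
  SmoothOver U φ ∧ InContactIdeal₂ U G (lieDeriv X (lagrangian G ε H Ξ) - extDeriv φ)

/-- `μ` represents a conservation law, i.e. a class in `H¹(Ω*(𝒞)/ℰ, d)`: `dμ ∈ ℰ`. -/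
def IsConservationLaw (U : Set E3) (G : E3 → E3 →L[ℝ] E3 →L[ℝ] ℝ) (ε : ℤˣ) (H : ℝ)
    (μ : Form 1) : Prop :=
  SmoothOver U μ ∧ InEulerLagrangeSystem₂ U G ε H (extDeriv μ)

/-- `μ` and `ν` have the same class modulo exact forms and modulo `ℰ`: `μ - ν = dh + a θ⁰` on `𝒞`. -/
def SameClass (U : Set E3) (G : E3 → E3 →L[ℝ] E3 →L[ℝ] ℝ) (μ ν : Form 1) : Prop :=
  ∃ h : TM → ℝ, SmoothOver U h ∧ InEulerLagrangeSystem₁ U G (μ - ν - differential h)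

/-- `μ` represents the Noether form of `X`: it is a conservation law, compensators `φ` of `X` exist, and
for all of them `μ = X ⌟ Λ - φ` modulo exact forms and modulo `ℰ`. -/
def IsNoetherForm (U : Set E3) (G : E3 → E3 →L[ℝ] E3 →L[ℝ] ℝ) (ε : ℤˣ) (H : ℝ)
    (Ξ : E3 → E3) (X : TM → TM) (μ : Form 1) : Prop :=
  IsConservationLaw U G ε H μ ∧
    (∃ φ : Form 1, IsCompensator U G ε H Ξ X φ) ∧
    ∀ φ : Form 1, IsCompensator U G ε H Ξ X φ →
      SameClass U G (contract X (lagrangian G ε H Ξ) - φ) μ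

/-- The expression `X ⌟ Λ₀ - 2H F^♭`. -/
def noetherExpr (G : E3 → E3 →L[ℝ] E3 →L[ℝ] ℝ) (ε : ℤˣ) (H : ℝ) (X : TM → TM) (F : E3 → E3) :
    Form 1 :=
  contract X (lagrangian₀ G ε) - (2 * H) • liftForm (flatForm G F)

end

end CMCNoether

open CMCNoether

/-! The flow of a Killing field preserves the metric, hence the volume form and the tautological
form `Λ₀ = e ⌟ vol`, so `L_S Λ₀ = 0`. For the volume term, `div Ξ = 1` means `dΛ' = vol`, and
Cartan's formula gives `L_S Λ' = d(S ⌟ Λ') + S ⌟ vol`. The form `S ⌟ vol` is closed because `div S =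
0`, so on a star-shaped domain the Poincaré lemma makes it `dF^♭`, which is the equation `curl F =
S`. Thus `L_S Λ = dφ_F` holds exactly, and `S ⌟ Λ - φ_F = S ⌟ Λ₀ - 2H F^♭`.

The conservation law comes from the structure equation `dΛ₀ + 2H vol = θ⁰ ∧ Ψ` on `𝒞`
(`extDeriv_lagrangian_eq`), contracted with `S`: since `d(S ⌟ Λ₀) = -S ⌟ dΛ₀`, one gets `dμ_S = θ⁰ ∧
(S ⌟ Ψ) - θ⁰(S) Ψ`.

For uniqueness, the difference `β` of two compensators satisfies `dβ = θ⁰ ∧ α + a dθ⁰`. Then `γ = β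
- a θ⁰` has `dγ = θ⁰ ∧ α'` with `α' = α + da`, and `d² = 0` forces `dθ⁰ ∧ α' = 0` on the contact
hyperplanes. These have dimension 4 and `dθ⁰` is symplectic on them, so `α'` is a multiple of `θ⁰`
and `dγ = 0` (`extDeriv_eq_zero_of_eq_wedge`). Finally `𝒞` retracts to a sphere up to homotopy, so
closed `1`-forms on it are exact (`exists_differential_eq`), and `β = dh + a θ⁰`. Independence of
the potential vector is the case where both compensators are of the form `φ_F`. -/

open CMCNoether

/-! ### Integrals depending on a parameter and the Poincaré lemma. -/

section Analysis

open Set intervalIntegral MeasureTheory Topology Interval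

/-- A field of alternating forms on a finite-dimensional space is smooth if its values on all
constant tuples are smooth. -/
theorem contDiffOn_of_forall_apply {D V : Type*} [NormedAddCommGroup D] [NormedSpace ℝ D]
    [NormedAddCommGroup V] [NormedSpace ℝ V] [FiniteDimensional ℝ V] {n : ℕ} {r : WithTop ℕ∞}
    {s : Set D} {f : D → V [⋀^Fin n]→L[ℝ] ℝ}
    (h : ∀ v : Fin n → V, ContDiffOn ℝ r (fun x => f x v) s) : ContDiffOn ℝ r f s := by
  let b := Module.finBasis ℝ V
  let L : (V [⋀^Fin n]→L[ℝ] ℝ) →ₗ[ℝ] ((Fin n → Fin (Module.finrank ℝ V)) → ℝ) :=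
    { toFun := fun η i => η fun j => b (i j)
      map_add' := fun _ _ => rfl
      map_smul' := fun _ _ => rfl }
  have hL : L.ker = ⊥ := by
    refine LinearMap.ker_eq_bot'.2 fun η hη => ?_
    have : η.toMultilinearMap = 0 :=
      Module.Basis.ext_multilinear (fun _ => b) fun i => congrFun hη i
    ext v
    exact congrArg (fun ζ => ζ v) this
  -- A form is recovered linearly from its finitely many values on basis tuples, and linear maps in
  -- finite dimension are smooth.
  obtain ⟨g, hg⟩ := L.exists_leftInverse_of_injective hL
  have hfg : f = fun x => LinearMap.toContinuousLinearMap g (L (f x)) :=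
    funext fun x => (LinearMap.congr_fun hg (f x)).symm
  rw [hfg]
  exact (LinearMap.toContinuousLinearMap g).contDiff.comp_contDiffOn
    (contDiffOn_pi.2 fun i => h _)

universe u

/-- A smooth function of `(x, t)` has a smooth integral over `t ∈ [0, 1]`, with derivative the
integral of the derivative. -/
theorem hasFDerivAt_integral_of_contDiffOn {E V : Type u} [NormedAddCommGroup E] [NormedSpace ℝ E]
    [NormedAddCommGroup V] [NormedSpace ℝ V] {U : Set E} {Ω : Set (E × ℝ)}
    (hU : IsOpen U) (hΩ : IsOpen Ω) (hsub : U ×ˢ Icc (0 : ℝ) 1 ⊆ Ω) {f : E × ℝ → V}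
    (hf : ContDiffOn ℝ 1 f Ω) {x : E} (hx : x ∈ U) :
    HasFDerivAt (fun x => ∫ t in (0 : ℝ)..1, f (x, t))
      (∫ t in (0 : ℝ)..1, (fderiv ℝ f (x, t)).comp (ContinuousLinearMap.inl ℝ E ℝ)) x := by
  have hf' : ContinuousOn (fun q => (fderiv ℝ f q).comp (ContinuousLinearMap.inl ℝ E ℝ)) Ω :=
    (hf.continuousOn_fderiv_of_isOpen hΩ le_rfl).clm_comp continuousOn_const
  have hline : ∀ z ∈ U, MapsTo (fun t : ℝ => (z, t)) (Icc 0 1) Ω :=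
    fun z hz t ht => hsub ⟨hz, ht⟩
  have hcont : ∀ z ∈ U, ContinuousOn (fun t : ℝ => f (z, t)) (uIcc 0 1) := by
    intro z hz
    rw [uIcc_of_le zero_le_one]
    exact hf.continuousOn.comp (by fun_prop) (hline z hz)
  have hcont' : ContinuousOn
      (fun t : ℝ => (fderiv ℝ f (x, t)).comp (ContinuousLinearMap.inl ℝ E ℝ)) (uIcc 0 1) := by
    rw [uIcc_of_le zero_le_one]
    exact hf'.comp (f := fun t : ℝ => (x, t)) (by fun_prop) (hline x hx)
  obtain ⟨C, hC⟩ := isCompact_uIcc.exists_bound_of_continuousOn hcont'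
  have hW : IsOpen (Ω ∩ (fun q => (fderiv ℝ f q).comp (ContinuousLinearMap.inl ℝ E ℝ)) ⁻¹'
      Metric.ball 0 (C + 1)) := hf'.isOpen_inter_preimage hΩ Metric.isOpen_ball
  -- The bound `C` on the segment over `x` persists as `C + 1` on a neighbourhood of it, and by
  -- compactness of `[0, 1]` on a tube `u × [0, 1]`; this constant is the dominating function.
  obtain ⟨u, v, hu, -, hxu, hv, huv⟩ := generalized_tube_lemma (isCompact_singleton (x := x))
    (isCompact_Icc (a := (0 : ℝ)) (b := 1)) hW (by
      rintro ⟨z, t⟩ ⟨rfl, ht⟩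
      refine ⟨hsub ⟨hx, ht⟩, ?_⟩
      have := hC t (by rwa [uIcc_of_le zero_le_one])
      simp only [mem_preimage, mem_ball_zero_iff]
      linarith)
  have hIoc : ∀ t, t ∈ Ι (0 : ℝ) 1 → t ∈ Icc (0 : ℝ) 1 := fun t ht => by
    rw [uIoc_of_le zero_le_one] at ht
    exact Ioc_subset_Icc_self ht
  refine hasFDerivAt_integral_of_dominated_of_fderiv_le (s := u) (bound := fun _ => C + 1)
    (F := fun x t => f (x, t))
    (F' := fun x t => (fderiv ℝ f (x, t)).comp (ContinuousLinearMap.inl ℝ E ℝ))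
    (hu.mem_nhds (hxu rfl)) ?_ ?_ ?_ ?_ ?_ ?_
  · filter_upwards [hU.mem_nhds hx] with z hz
    exact ((hcont z hz).mono uIoc_subset_uIcc).aestronglyMeasurable measurableSet_uIoc
  · exact (hcont x hx).intervalIntegrable
  · exact (hcont'.mono uIoc_subset_uIcc).aestronglyMeasurable measurableSet_uIoc
  · refine Filter.Eventually.of_forall fun t ht z hz => ?_
    have := (huv (⟨hz, hv (hIoc t ht)⟩ : (z, t) ∈ u ×ˢ v)).2
    exact (mem_ball_zero_iff.1 this).le
  · exact intervalIntegrable_const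
  · refine Filter.Eventually.of_forall fun t ht z hz => ?_
    have hzt : (z, t) ∈ Ω := (huv (⟨hz, hv (hIoc t ht)⟩ : (z, t) ∈ u ×ˢ v)).1
    have h1 : HasFDerivAt f (fderiv ℝ f (z, t)) (z, t) :=
      ((hf.contDiffAt (hΩ.mem_nhds hzt)).differentiableAt one_ne_zero).hasFDerivAt
    exact h1.comp z (hasFDerivAt_prodMk_left z t)

/-- Differentiating under the integral gives another integral of the same kind, with values in `E
→L[ℝ] V`. The induction therefore runs over all `V` at once, and `E`, `V` share a universe so that
it contains the new target. -/
theorem contDiffOn_integral_nat {E : Type u} [NormedAddCommGroup E] [NormedSpace ℝ E]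
    {U : Set E} {Ω : Set (E × ℝ)} (hU : IsOpen U) (hΩ : IsOpen Ω)
    (hsub : U ×ˢ Icc (0 : ℝ) 1 ⊆ Ω) (n : ℕ) :
    ∀ {V : Type u} [NormedAddCommGroup V] [NormedSpace ℝ V] {f : E × ℝ → V},
      ContDiffOn ℝ ∞ f Ω → ContDiffOn ℝ n (fun x => ∫ t in (0 : ℝ)..1, f (x, t)) U := by
  induction n with
  | zero =>
    intro V _ _ f hf
    refine contDiffOn_zero.2 fun x hx => ?_
    exact (hasFDerivAt_integral_of_contDiffOn hU hΩ hsub (hf.of_le (by norm_cast))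
      hx).continuousAt.continuousWithinAt
  | succ n ih =>
    intro V _ _ f hf
    have hd := fun x hx => hasFDerivAt_integral_of_contDiffOn (x := x) hU hΩ hsub
      (hf.of_le (by norm_cast)) hx
    push_cast
    refine (contDiffOn_succ_iff_fderiv_of_isOpen hU).2 ⟨fun x hx =>
      (hd x hx).differentiableAt.differentiableWithinAt, by simp, ?_⟩
    refine ContDiffOn.congr (ih (f := fun q =>
      (fderiv ℝ f q).comp (ContinuousLinearMap.inl ℝ E ℝ)) ?_) fun x hx => (hd x hx).fderiv
    exact (hf.fderiv_of_isOpen hΩ (by norm_cast)).clm_comp contDiffOn_const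

theorem contDiffOn_integral {E V : Type u} [NormedAddCommGroup E] [NormedSpace ℝ E]
    [NormedAddCommGroup V] [NormedSpace ℝ V] {U : Set E} {Ω : Set (E × ℝ)}
    (hU : IsOpen U) (hΩ : IsOpen Ω) (hsub : U ×ˢ Icc (0 : ℝ) 1 ⊆ Ω) {f : E × ℝ → V}
    (hf : ContDiffOn ℝ ∞ f Ω) : ContDiffOn ℝ ∞ (fun x => ∫ t in (0 : ℝ)..1, f (x, t)) U :=
  contDiffOn_infty.2 fun n => contDiffOn_integral_nat hU hΩ hsub n hf

/-- Serves with `A` the alternatization map: it moves the exterior derivative under the integral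
sign. -/
theorem clm_apply_fderiv_integral {E V W : Type u} [NormedAddCommGroup E] [NormedSpace ℝ E]
    [NormedAddCommGroup V] [NormedSpace ℝ V] [CompleteSpace V]
    [NormedAddCommGroup W] [NormedSpace ℝ W] [CompleteSpace W] {U : Set E} {Ω : Set (E × ℝ)}
    (hU : IsOpen U) (hΩ : IsOpen Ω) (hsub : U ×ˢ Icc (0 : ℝ) 1 ⊆ Ω) {f : E × ℝ → V}
    (hf : ContDiffOn ℝ 1 f Ω) {x : E} (hx : x ∈ U) (A : (E →L[ℝ] V) →L[ℝ] W) :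
    A (fderiv ℝ (fun x => ∫ t in (0 : ℝ)..1, f (x, t)) x) =
        ∫ t in (0 : ℝ)..1, A ((fderiv ℝ f (x, t)).comp (ContinuousLinearMap.inl ℝ E ℝ)) ∧
      IntervalIntegrable
        (fun t => A ((fderiv ℝ f (x, t)).comp (ContinuousLinearMap.inl ℝ E ℝ))) volume 0 1 := by
  have hc : ContinuousOn
      (fun t : ℝ => (fderiv ℝ f (x, t)).comp (ContinuousLinearMap.inl ℝ E ℝ)) (uIcc 0 1) := by
    rw [uIcc_of_le zero_le_one]
    exact ((hf.continuousOn_fderiv_of_isOpen hΩ le_rfl).clm_comp continuousOn_const).comp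
      (f := fun t : ℝ => (x, t)) (by fun_prop) fun t ht => hsub ⟨hx, ht⟩
  rw [(hasFDerivAt_integral_of_contDiffOn hU hΩ hsub hf hx).fderiv,
    ← ContinuousLinearMap.intervalIntegral_comp_comm _ hc.intervalIntegrable]
  exact ⟨rfl, (A.continuous.comp_continuousOn hc).intervalIntegrable⟩

/-- This is the integrand of the radial homotopy operator, with `c` the contraction of a form with a
vector. -/
theorem contDiffOn_pow_smul_segment {E A B : Type*} [NormedAddCommGroup E] [NormedSpace ℝ E]
    [NormedAddCommGroup A] [NormedSpace ℝ A] [NormedAddCommGroup B] [NormedSpace ℝ B]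
    (c : A →L[ℝ] E →L[ℝ] B) {η : E → A} {U : Set E} (hη : ContDiffOn ℝ ∞ η U) (n : ℕ) (y : E) :
    ContDiffOn ℝ ∞ (fun q : E × ℝ => q.2 ^ n • c (η (y + q.2 • (q.1 - y))) (q.1 - y))
      ((fun q : E × ℝ => y + q.2 • (q.1 - y)) ⁻¹' U) := by
  have h1 : ContDiff ℝ ∞ fun q : E × ℝ => q.2 ^ n := by fun_prop
  have h2 : ContDiff ℝ ∞ fun q : E × ℝ => q.1 - y := by fun_prop
  have h3 : ContDiff ℝ ∞ fun q : E × ℝ => y + q.2 • (q.1 - y) := by fun_prop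
  have h4 := c.contDiff.comp_contDiffOn (hη.comp h3.contDiffOn fun q hq => hq)
  exact h1.contDiffOn.smul (h4.clm_apply h2.contDiffOn)

/-- Product rule: the chain rule along `y + t (z - y)` contributes one more factor `t`, hence the
exponent `n + 1` in the first term. -/
theorem hasFDerivAt_pow_smul_segment {E A B : Type*} [NormedAddCommGroup E] [NormedSpace ℝ E]
    [NormedAddCommGroup A] [NormedSpace ℝ A] [NormedAddCommGroup B] [NormedSpace ℝ B]
    (c : A →L[ℝ] E →L[ℝ] B) {η : E → A} {η' : E →L[ℝ] A} {x y : E} {t : ℝ}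
    (hη : HasFDerivAt η η' (y + t • (x - y))) (n : ℕ) :
    HasFDerivAt (fun z => t ^ n • c (η (y + t • (z - y))) (z - y))
      (t ^ (n + 1) • ((ContinuousLinearMap.apply ℝ B (x - y)).comp (c.comp η')) +
        t ^ n • c (η (y + t • (x - y)))) x := by
  have h1 : HasFDerivAt (fun z : E => y + t • (z - y)) (t • ContinuousLinearMap.id ℝ E) x :=
    (((hasFDerivAt_id x).sub_const y).const_smul t).const_add y
  have h2 := ((c.hasFDerivAt.comp x (hη.comp x h1)).clm_apply
    ((hasFDerivAt_id x).sub_const y)).const_smul (t ^ n)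
  convert! h2 using 1
  ext u
  simp [pow_succ, smul_smul]
  abel

/-- The Poincaré lemma on star-shaped open sets. -/
theorem exists_extDeriv_eq_of_starConvex {E : Type u} [NormedAddCommGroup E] [NormedSpace ℝ E]
    {n : ℕ} {U : Set E} (hU : IsOpen U) {y : E} (hy : StarConvex ℝ y U)
    {η : E → E [⋀^Fin (n + 1)]→L[ℝ] ℝ} (hη : ContDiffOn ℝ ∞ η U)
    (hd : ∀ x ∈ U, extDeriv η x = 0) :
    ∃ β : E → E [⋀^Fin n]→L[ℝ] ℝ, ContDiffOn ℝ ∞ β U ∧ ∀ x ∈ U, extDeriv β x = η x := by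
  let γ : E × ℝ → E := fun q => y + q.2 • (q.1 - y)
  have hγ : ContDiff ℝ ∞ γ := by fun_prop
  let Ω : Set (E × ℝ) := γ ⁻¹' U
  have hΩ : IsOpen Ω := hU.preimage hγ.continuous
  have hsub : U ×ˢ Icc (0 : ℝ) 1 ⊆ Ω := fun q hq => hy.add_smul_sub_mem hq.1 hq.2.1 hq.2.2
  let c : (E [⋀^Fin (n + 1)]→L[ℝ] ℝ) →L[ℝ] E →L[ℝ] E [⋀^Fin n]→L[ℝ] ℝ :=
    ContinuousAlternatingMap.curryLeftLI.toContinuousLinearMap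
  -- The primitive is `∫₀¹ tⁿ (x - y) ⌟ η(y + t(x - y)) dt`.
  let f : E × ℝ → E [⋀^Fin n]→L[ℝ] ℝ := fun q => q.2 ^ n • c (η (γ q)) (q.1 - y)
  have hf : ContDiffOn ℝ ∞ f Ω := contDiffOn_pow_smul_segment c hη n y
  refine ⟨fun x => ∫ t in (0 : ℝ)..1, f (x, t), contDiffOn_integral hU hΩ hsub hf,
    fun x hx => ?_⟩
  obtain ⟨hA, hI⟩ := clm_apply_fderiv_integral hU hΩ hsub (hf.of_le (by norm_cast)) hx
    (ContinuousAlternatingMap.alternatizeUncurryFinCLM ℝ E ℝ)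
  rw [extDeriv, ← ContinuousAlternatingMap.alternatizeUncurryFinCLM_apply, hA]
  have hηd : ∀ t ∈ Icc (0 : ℝ) 1, HasFDerivAt η (fderiv ℝ η (γ (x, t))) (γ (x, t)) :=
    fun t ht => ((hη.contDiffAt (hU.mem_nhds (hsub ⟨hx, ht⟩))).differentiableAt
      (by simp)).hasFDerivAt
  have hfd : ∀ t ∈ Icc (0 : ℝ) 1, (fderiv ℝ f (x, t)).comp (ContinuousLinearMap.inl ℝ E ℝ) =
      t ^ (n + 1) • ((ContinuousLinearMap.apply ℝ _ (x - y)).comp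
        (c.comp (fderiv ℝ η (γ (x, t))))) + t ^ n • c (η (γ (x, t))) := by
    intro t ht
    have h1 : HasFDerivAt (fun z => f (z, t))
        ((fderiv ℝ f (x, t)).comp (ContinuousLinearMap.inl ℝ E ℝ)) x :=
      ((hf.contDiffAt (hΩ.mem_nhds (hsub ⟨hx, ht⟩))).differentiableAt
        (by simp)).hasFDerivAt.comp x (hasFDerivAt_prodMk_left x t)
    exact h1.unique (hasFDerivAt_pow_smul_segment c (hηd t ht) n)
  -- Expand `dη = 0` on `(x - y, v)`: the term differentiating along `x - y` equals the alternating
  -- sum of those differentiating along `v`.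
  have halt : ∀ t ∈ Icc (0 : ℝ) 1, ContinuousAlternatingMap.alternatizeUncurryFin
      ((ContinuousLinearMap.apply ℝ _ (x - y)).comp (c.comp (fderiv ℝ η (γ (x, t))))) =
      fderiv ℝ η (γ (x, t)) (x - y) := by
    intro t ht
    ext v
    have hrem : ∀ (w : E) (i : Fin (n + 1)), Fin.removeNth i.succ (Matrix.vecCons w v : Fin (n + 2) → E) =
        Matrix.vecCons w (i.removeNth v) := by
      intro w i
      ext j
      refine Fin.cases ?_ (fun j => ?_) j <;> simp [Fin.removeNth]
    have h0 := congrArg (fun ζ => ζ (Matrix.vecCons (x - y) v)) (hd (γ (x, t)) (hsub ⟨hx, ht⟩))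
    rw [extDeriv] at h0
    simp only [ContinuousAlternatingMap.alternatizeUncurryFin_apply] at h0 ⊢
    rw [Fin.sum_univ_succ] at h0
    simp only [hrem, Fin.val_succ, pow_succ, mul_neg, mul_one, neg_smul, Finset.sum_neg_distrib,
      Matrix.cons_val_succ] at h0
    have h1 := (sub_eq_zero.1 ((sub_eq_add_neg _ _).trans h0)).symm
    simpa [Fin.removeNth_zero, c] using h1
  -- The integrand of `dβ` is the `t`-derivative of `t^(n+1) η(γ(x, t))`, because alternating a
  -- contraction of `η` multiplies it by its degree `n + 1`. The boundary value is `η x` at `t = 1`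
  -- and zero at `t = 0`.
  have hder : ∀ t ∈ uIcc (0 : ℝ) 1, HasDerivAt (fun t : ℝ => t ^ (n + 1) • η (γ (x, t)))
      (ContinuousAlternatingMap.alternatizeUncurryFinCLM ℝ E ℝ
        ((fderiv ℝ f (x, t)).comp (ContinuousLinearMap.inl ℝ E ℝ))) t := by
    intro t ht
    rw [uIcc_of_le zero_le_one] at ht
    have h2 : HasDerivAt (fun t : ℝ => y + t • (x - y)) ((1 : ℝ) • (x - y)) t :=
      ((hasDerivAt_id t).smul_const (x - y)).const_add y
    have h3 := (hasDerivAt_pow (n + 1) t).smul ((hηd t ht).comp_hasDerivAt t h2)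
    convert! h3 using 1
    rw [hfd t ht, map_add, map_smul, map_smul]
    simp only [ContinuousAlternatingMap.alternatizeUncurryFinCLM_apply, halt t ht]
    have : c (η (γ (x, t))) = (η (γ (x, t))).curryLeft := rfl
    rw [this, ContinuousAlternatingMap.alternatizeUncurryFin_curryLeft]
    ext v
    simp
    ring
  rw [integral_eq_sub_of_hasDerivAt hder hI]
  simp [γ]

/-! ### The exterior derivative evaluated on vectors. -/

section Formulas

variable {E : Type*} [NormedAddCommGroup E] [NormedSpace ℝ E]

theorem extDeriv_apply_two (η : E → E [⋀^Fin 1]→L[ℝ] ℝ) (x u v : E) :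
    extDeriv η x ![u, v] = fderiv ℝ η x u ![v] - fderiv ℝ η x v ![u] := by
  have h1 : Fin.removeNth 0 ![u, v] = ![v] := by ext i; fin_cases i; rfl
  have h2 : Fin.removeNth 1 ![u, v] = ![u] := by ext i; fin_cases i; rfl
  simp [extDeriv, ContinuousAlternatingMap.alternatizeUncurryFin_apply, Fin.sum_univ_succ, h1, h2,
    sub_eq_add_neg]

theorem extDeriv_apply_three (η : E → E [⋀^Fin 2]→L[ℝ] ℝ) (x u v w : E) :
    extDeriv η x ![u, v, w] =
      fderiv ℝ η x u ![v, w] - fderiv ℝ η x v ![u, w] + fderiv ℝ η x w ![u, v] := by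
  have h1 : Fin.removeNth 0 ![u, v, w] = ![v, w] := by ext i; fin_cases i <;> rfl
  have h2 : Fin.removeNth 1 ![u, v, w] = ![u, w] := by ext i; fin_cases i <;> rfl
  have h3 : Fin.removeNth 2 ![u, v, w] = ![u, v] := by ext i; fin_cases i <;> rfl
  simp [extDeriv, ContinuousAlternatingMap.alternatizeUncurryFin_apply, Fin.sum_univ_succ, h1, h2,
    h3, sub_eq_add_neg, add_assoc]

theorem contDiffOn_extDeriv {n : ℕ} {U : Set E} (hU : IsOpen U) {η : E → E [⋀^Fin n]→L[ℝ] ℝ}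
    (hη : ContDiffOn ℝ ∞ η U) : ContDiffOn ℝ ∞ (extDeriv η) U := by
  have h := hη.fderiv_of_isOpen (m := ∞) hU (by simp)
  exact (ContinuousAlternatingMap.alternatizeUncurryFinCLM ℝ E ℝ).contDiff.comp_contDiffOn h

end Formulas

end Analysis

/-! ### Smoothness and positivity of coordinate expressions in a chart. -/

section Charts

variable {M : Type*} [TopologicalSpace M] [ChartedSpace (EuclideanSpace ℝ (Fin 3)) M]

theorem contMDiffAt_chart_symm_of_mem_target {c : OpenPartialHomeomorph M E3}
    (hc : c ∈ IsManifold.maximalAtlas (𝓡 3) ∞ M) {y : E3} (hy : y ∈ c.target) :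
    ContMDiffAt (𝓡 3) (𝓡 3) ∞ c.symm y :=
  (contMDiffOn_symm_of_mem_maximalAtlas hc).contMDiffAt (c.open_target.mem_nhds hy)

theorem isInvertible_chartDeriv {c : OpenPartialHomeomorph M E3}
    (hc : c ∈ IsManifold.maximalAtlas (𝓡 3) ∞ M) {y : E3} (hy : y ∈ c.target) :
    (chartDeriv c y).IsInvertible := by
  have h : c.MDifferentiable (𝓡 3) (𝓡 3) :=
    ⟨(contMDiffOn_of_mem_maximalAtlas hc).mdifferentiableOn (by simp),
      (contMDiffOn_symm_of_mem_maximalAtlas hc).mdifferentiableOn (by simp)⟩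
  exact ⟨h.symm.mfderiv hy, rfl⟩

variable [IsManifold (𝓡 3) ∞ M]

theorem contDiffOn_coordField {S : (x : M) → TangentSpace (𝓡 3) x}
    (hS : ContMDiff (𝓡 3) (𝓡 3).tangent ∞ (fun x => (⟨x, S x⟩ : TangentBundle (𝓡 3) M)))
    {c : OpenPartialHomeomorph M E3} (hc : c ∈ IsManifold.maximalAtlas (𝓡 3) ∞ M) :
    ContDiffOn ℝ ∞ (coordField S c) c.target := by
  intro y hy
  have h := ContMDiffAt.mpullback_vectorField_preimage (x₀ := y) (V := S) (m := ∞) (n := ∞)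
    (hS (c.symm y)) (contMDiffAt_chart_symm_of_mem_target hc hy) (isInvertible_chartDeriv hc hy)
    (by simp)
  exact (contMDiffAt_vectorSpace_iff_contDiffAt.1 h).contDiffWithinAt

theorem coordMetric_symm (g : RiemMetric M) (c : OpenPartialHomeomorph M E3) (y u v : E3) :
    coordMetric g c y u v = coordMetric g c y v u :=
  g.symm _ _ _

theorem coordMetric_pos (g : RiemMetric M) {c : OpenPartialHomeomorph M E3}
    (hc : c ∈ IsManifold.maximalAtlas (𝓡 3) ∞ M) {y : E3} (hy : y ∈ c.target) {u : E3}
    (hu : u ≠ 0) : 0 < coordMetric g c y u u := by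
  refine g.pos _ _ fun h => hu ?_
  exact (isInvertible_chartDeriv hc hy).injective (h.trans (map_zero _).symm)

theorem contDiffOn_coordMetric (g : RiemMetric M) {c : OpenPartialHomeomorph M E3}
    (hc : c ∈ IsManifold.maximalAtlas (𝓡 3) ∞ M) :
    ContDiffOn ℝ ∞ (coordMetric g c) c.target := by
  refine contDiffOn_clm_apply.2 fun u => contDiffOn_clm_apply.2 fun v y hy => ?_
  have hsymm := contMDiffAt_chart_symm_of_mem_target hc hy
  -- A constant coordinate vector, pushed forward by the tangent map of `c.symm`, is a smooth
  -- section along `c.symm`; the metric coefficients pair two of these.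
  have hT : ∀ w : E3, ContMDiffAt (𝓡 3) (𝓡 3).tangent ∞
      (fun y => (⟨c.symm y, chartDeriv c y w⟩ : TangentBundle (𝓡 3) M)) y := by
    intro w
    have h1 := (contMDiffOn_symm_of_mem_maximalAtlas hc).contMDiffOn_tangentMapWithin
      (m := ∞) (by simp) c.open_target.uniqueMDiffOn
    have h2 : ContMDiffAt (𝓡 3) (𝓡 3).tangent ∞
        (fun y => (⟨y, w⟩ : TangentBundle (𝓡 3) E3)) y :=
      contMDiffAt_vectorSpace_iff_contDiffAt.2 contDiffAt_const
    have h3 := (h1 ⟨y, w⟩ hy).comp y (h2.contMDiffWithinAt (s := c.target)) fun z hz => hz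
    refine (h3.contMDiffAt (c.open_target.mem_nhds hy)).congr_of_eventuallyEq ?_
    filter_upwards [c.open_target.mem_nhds hy] with z hz
    simp only [Function.comp_apply, tangentMapWithin, chartDeriv,
      mfderivWithin_of_isOpen c.open_target hz]
    rfl
  have h : ContMDiffAt (𝓡 3) ((𝓡 3).prod 𝓘(ℝ)) ∞
      (fun y => Bundle.TotalSpace.mk' ℝ (E := Bundle.Trivial M ℝ) (c.symm y)
        (g.inner (c.symm y) (chartDeriv c y u) (chartDeriv c y v))) y := by
    apply ContMDiffAt.clm_bundle_apply₂ (F₁ := E3) (F₂ := E3)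
    · exact g.contMDiff.contMDiffAt.comp y hsymm
    · exact hT u
    · exact hT v
  exact (Bundle.contMDiffAt_totalSpace.1 h).2.contDiffAt.contDiffWithinAt

end Charts

/-! ### Determinant identities in dimension three. -/

section LinearAlgebra

theorem detForm_apply (a b c : E3) : detForm ![a, b, c] =
    a 0 * (b 1 * c 2 - b 2 * c 1) - a 1 * (b 0 * c 2 - b 2 * c 0)
      + a 2 * (b 0 * c 1 - b 1 * c 0) := by
  change (EuclideanSpace.basisFun (Fin 3) ℝ).toBasis.det ![a, b, c] = _
  rw [Module.Basis.det_apply, Matrix.det_fin_three]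
  simp [Module.Basis.toMatrix_apply]
  ring

theorem eq_sum_frame (u : E3) : u = u 0 • frame 0 + u 1 • frame 1 + u 2 • frame 2 := by
  ext i
  fin_cases i <;> simp [frame]

theorem map_eq_sum_frame {V : Type*} [NormedAddCommGroup V] [NormedSpace ℝ V] (A : E3 →L[ℝ] V)
    (u : E3) : A u = u 0 • A (frame 0) + u 1 • A (frame 1) + u 2 • A (frame 2) := by
  conv_lhs => rw [eq_sum_frame u]
  simp only [map_add, map_smul]

theorem bilin_eq_sum_frame (B : E3 →L[ℝ] E3 →L[ℝ] ℝ) (u v : E3) :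
    B u v = ∑ i, ∑ j, u i * v j * B (frame i) (frame j) := by
  rw [map_eq_sum_frame B u]
  simp only [add_apply, smul_apply,
    map_eq_sum_frame _ v, Fin.sum_univ_three, smul_eq_mul]
  ring

/-- A linear form and the determinant of three of four vectors, antisymmetrized. -/
theorem sum_mul_detForm_eq_zero (A : E3 →L[ℝ] ℝ) (a b c d : E3) :
    A a * detForm ![b, c, d] - A b * detForm ![a, c, d] + A c * detForm ![a, b, d]
      - A d * detForm ![a, b, c] = 0 := by
  -- The expression is `A ∧ det`, an alternating `4`-form on a `3`-dimensional space.
  simp only [detForm_apply, map_eq_sum_frame A a, map_eq_sum_frame A b, map_eq_sum_frame A c,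
    map_eq_sum_frame A d, smul_eq_mul]
  ring

/-- The trace of an endomorphism of `E3`. -/
noncomputable def traceE3 (A : E3 →L[ℝ] E3) : ℝ := ∑ i, A (frame i) i

/-- The infinitesimal action of an endomorphism on the volume form is multiplication by its trace:
this is the derivative of `det (1 + tA)` at `t = 0`. -/
theorem sum_detForm_eq_trace_mul (A : E3 →L[ℝ] E3) (a b c : E3) :
    detForm ![A a, b, c] + detForm ![a, A b, c] + detForm ![a, b, A c] =
      traceE3 A * detForm ![a, b, c] := by
  simp only [detForm_apply, map_eq_sum_frame A a, map_eq_sum_frame A b, map_eq_sum_frame A c,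
    PiLp.add_apply, PiLp.smul_apply, smul_eq_mul, traceE3, Fin.sum_univ_three]
  ring

/-- Jacobi's formula, kept with the adjugate so that no inverse matrix appears. -/
theorem hasFDerivAt_det_three {E : Type*} [NormedAddCommGroup E] [NormedSpace ℝ E]
    {A : E → Matrix (Fin 3) (Fin 3) ℝ} {A' : Fin 3 → Fin 3 → E →L[ℝ] ℝ} {x : E}
    (h : ∀ i j, HasFDerivAt (fun y => A y i j) (A' i j) x) :
    HasFDerivAt (fun y => (A y).det) (∑ i, ∑ j, (A x).adjugate j i • A' i j) x := by
  simp only [Matrix.det_fin_three]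
  convert! ((((((h 0 0).mul (h 1 1)).mul (h 2 2)).sub (((h 0 0).mul (h 1 2)).mul (h 2 1))).sub
    (((h 0 1).mul (h 1 0)).mul (h 2 2))).add (((h 0 1).mul (h 1 2)).mul (h 2 0))).add
    (((h 0 2).mul (h 1 0)).mul (h 2 1)) |>.sub (((h 0 2).mul (h 1 1)).mul (h 2 0)) using 1
  ext v
  simp [Matrix.adjugate_fin_three, Fin.sum_univ_three]
  ring

end LinearAlgebra

/-! ### Volume density and Levi-Civita connection of a coordinate metric. -/

/-- The coordinate expression of a smooth Riemannian metric on an open set. -/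
structure IsMetricOn (U : Set E3) (G : E3 → E3 →L[ℝ] E3 →L[ℝ] ℝ) : Prop where
  isOpen : IsOpen U
  contDiffOn : ContDiffOn ℝ ∞ G U
  symm : ∀ x u v, G x u v = G x v u
  pos : ∀ x ∈ U, ∀ u ≠ 0, 0 < G x u u

/-- The density `√(det g)` of the Riemannian volume. -/
noncomputable def density (G : E3 → E3 →L[ℝ] E3 →L[ℝ] ℝ) (x : E3) : ℝ :=
  Real.sqrt (gram G x).det

theorem volForm_apply (G : E3 → E3 →L[ℝ] E3 →L[ℝ] ℝ) (ε : ℤˣ) (x : E3) (v : Fin 3 → E3) :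
    volForm G ε x v = ((ε : ℤ) : ℝ) * density G x * detForm v := rfl

namespace IsMetricOn

variable {U : Set E3} {G : E3 → E3 →L[ℝ] E3 →L[ℝ] ℝ} (hG : IsMetricOn U G)
include hG

theorem differentiableAt {x : E3} (hx : x ∈ U) : DifferentiableAt ℝ G x :=
  (hG.contDiffOn.contDiffAt (hG.isOpen.mem_nhds hx)).differentiableAt (by simp)

theorem hasFDerivAt_apply {x : E3} (hx : x ∈ U) (u v : E3) :
    HasFDerivAt (fun y => G y u v) (((fderiv ℝ G x).flip u).flip v) x := by
  have h := ((hG.differentiableAt hx).hasFDerivAt.clm_apply (hasFDerivAt_const u x)).clm_apply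
    (hasFDerivAt_const v x)
  convert! h using 1
  ext w
  simp

theorem fderiv_symm {x : E3} (hx : x ∈ U) (w u v : E3) :
    fderiv ℝ G x w u v = fderiv ℝ G x w v u := by
  have h := (hG.hasFDerivAt_apply hx u v).unique
    ((hG.hasFDerivAt_apply hx v u).congr_of_eventuallyEq
      (Filter.Eventually.of_forall fun y => hG.symm y u v))
  exact congrArg (fun A => A w) h

theorem posDef_gram {x : E3} (hx : x ∈ U) : (gram G x).PosDef := by
  refine Matrix.PosDef.of_dotProduct_mulVec_pos ?_ ?_
  · ext i j
    simp [gram, hG.symm x (frame j) (frame i)]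
  · intro v hv
    have h := hG.pos x hx (WithLp.toLp 2 v) fun h => hv (by simpa using h)
    rw [bilin_eq_sum_frame] at h
    simp only [Fin.sum_univ_three] at h
    simp [dotProduct, Matrix.mulVec, gram, Fin.sum_univ_three]
    linarith

theorem det_gram_pos {x : E3} (hx : x ∈ U) : 0 < (gram G x).det := (hG.posDef_gram hx).det_pos

theorem density_pos {x : E3} (hx : x ∈ U) : 0 < density G x := Real.sqrt_pos.2 (hG.det_gram_pos hx)

theorem contDiffOn_gram (i j : Fin 3) : ContDiffOn ℝ ∞ (fun x => gram G x i j) U :=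
  (hG.contDiffOn.clm_apply contDiffOn_const).clm_apply contDiffOn_const

theorem contDiffOn_det_gram : ContDiffOn ℝ ∞ (fun x => (gram G x).det) U := by
  simp only [Matrix.det_fin_three]
  have h := hG.contDiffOn_gram
  exact ((((((h 0 0).mul (h 1 1)).mul (h 2 2)).sub (((h 0 0).mul (h 1 2)).mul (h 2 1))).sub
    (((h 0 1).mul (h 1 0)).mul (h 2 2))).add (((h 0 1).mul (h 1 2)).mul (h 2 0))).add
    (((h 0 2).mul (h 1 0)).mul (h 2 1)) |>.sub (((h 0 2).mul (h 1 1)).mul (h 2 0))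

theorem contDiffOn_density : ContDiffOn ℝ ∞ (density G) U :=
  hG.contDiffOn_det_gram.sqrt fun _ hx => (hG.det_gram_pos hx).ne'

theorem contDiffOn_inv_gram (i j : Fin 3) : ContDiffOn ℝ ∞ (fun x => (gram G x)⁻¹ i j) U := by
  have h := hG.contDiffOn_gram
  have hadj : ContDiffOn ℝ ∞ (fun x => (gram G x).adjugate i j) U := by
    simp only [Matrix.adjugate_fin_three]
    fin_cases i <;> fin_cases j <;> simp <;> fun_prop
  simp only [Matrix.inv_def, Ring.inverse_eq_inv', Matrix.smul_apply, smul_eq_mul]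
  exact (hG.contDiffOn_det_gram.inv fun x hx => (hG.det_gram_pos hx).ne').mul hadj

/-- Jacobi's formula applied to the square of the density, which is `det g`. -/
theorem fderiv_density {x : E3} (hx : x ∈ U) (v : E3) :
    2 * density G x * fderiv ℝ (density G) x v =
      ∑ i, ∑ j, (gram G x).adjugate j i * fderiv ℝ G x v (frame i) (frame j) := by
  have h := (hasFDerivAt_det_three (A := gram G) fun i j =>
    hG.hasFDerivAt_apply hx (frame i) (frame j)).sqrt (hG.det_gram_pos hx).ne'
  change HasFDerivAt (density G) _ x at h
  rw [h.fderiv]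
  have := (hG.density_pos hx).ne'
  change _ * ((1 / (2 * density G x)) • _ : E3 →L[ℝ] ℝ) v = _
  simp [Fin.sum_univ_three]
  field_simp

end IsMetricOn

theorem gram_apply (G : E3 → E3 →L[ℝ] E3 →L[ℝ] ℝ) (x : E3) (i j : Fin 3) :
    gram G x i j = G x (frame i) (frame j) := rfl

theorem christoffel_apply (G : E3 → E3 →L[ℝ] E3 →L[ℝ] ℝ) (x u v : E3) (i : Fin 3) :
    christoffel G x u v i = ∑ l, (gram G x)⁻¹ i l *
      ((fderiv ℝ G x u v (frame l) + fderiv ℝ G x v u (frame l) - fderiv ℝ G x (frame l) u v) / 2) :=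
  rfl

/-- The endomorphism `u ↦ Γ_x(u, v)`. -/
noncomputable def christoffelMap (G : E3 → E3 →L[ℝ] E3 →L[ℝ] ℝ) (x v : E3) : E3 →L[ℝ] E3 :=
  LinearMap.toContinuousLinearMap
    { toFun := fun u => christoffel G x u v
      map_add' := fun u u' => by
        ext i
        simp only [christoffel_apply, PiLp.add_apply, map_add, add_apply, ← Finset.sum_add_distrib]
        exact Finset.sum_congr rfl fun l _ => by ring
      map_smul' := fun a u => by
        ext i
        simp only [christoffel_apply, PiLp.smul_apply, map_smul, smul_apply, smul_eq_mul,
          Finset.mul_sum, RingHom.id_apply]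
        exact Finset.sum_congr rfl fun l _ => by ring }

theorem christoffelMap_apply (G : E3 → E3 →L[ℝ] E3 →L[ℝ] ℝ) (x v u : E3) :
    christoffelMap G x v u = christoffel G x u v := rfl

namespace IsMetricOn

variable {U : Set E3} {G : E3 → E3 →L[ℝ] E3 →L[ℝ] ℝ} (hG : IsMetricOn U G)
include hG

/-- The vector with covariant components `b`. -/
theorem inner_inv_gram_mulVec {x : E3} (hx : x ∈ U) (b : Fin 3 → ℝ) (l : Fin 3) :
    G x (WithLp.toLp 2 ((gram G x)⁻¹.mulVec b)) (frame l) = b l := by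
  have h : (gram G x).mulVec ((gram G x)⁻¹.mulVec b) = b := by
    rw [Matrix.mulVec_mulVec, Matrix.mul_nonsing_inv _ (hG.det_gram_pos hx).ne'.isUnit,
      Matrix.one_mulVec]
  rw [hG.symm, map_eq_sum_frame (G x (frame l))]
  conv_rhs => rw [← h]
  simp only [Matrix.mulVec, dotProduct, Fin.sum_univ_three, gram_apply, smul_eq_mul]
  ring

/-- Koszul's formula: pairing with the metric cancels the inverse Gram matrix, and later
computations use only this lowered form. -/
theorem inner_christoffel {x : E3} (hx : x ∈ U) (u v w : E3) :
    G x (christoffel G x u v) w =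
      (fderiv ℝ G x u v w + fderiv ℝ G x v u w - fderiv ℝ G x w u v) / 2 := by
  have hframe : ∀ l, G x (christoffel G x u v) (frame l) =
      (fderiv ℝ G x u v (frame l) + fderiv ℝ G x v u (frame l)
        - fderiv ℝ G x (frame l) u v) / 2 := fun l => hG.inner_inv_gram_mulVec hx _ l
  rw [map_eq_sum_frame (G x _) w, hframe, hframe, hframe, map_eq_sum_frame (fderiv ℝ G x u v) w,
    map_eq_sum_frame (fderiv ℝ G x v u) w, map_eq_sum_frame (fderiv ℝ G x) w]
  simp only [add_apply, smul_apply, smul_eq_mul]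
  ring

/-- In the trace of `Γ(·, e)`, the first and third derivatives of the metric cancel by symmetry of
the inverse matrix. What remains is half the trace of `g⁻¹ ∂_e g`, the logarithmic derivative of
`√(det g)`. -/
theorem trace_christoffelMap {x : E3} (hx : x ∈ U) (e : E3) :
    density G x * traceE3 (christoffelMap G x e) = fderiv ℝ (density G) x e := by
  have hρ := hG.density_pos hx
  have hsq : density G x ^ 2 = (gram G x).det := Real.sq_sqrt (hG.det_gram_pos hx).le
  have hsymm : ∀ i j, (gram G x)⁻¹ i j = (gram G x)⁻¹ j i := fun i j =>
    (hG.posDef_gram hx).isHermitian.inv.apply i j |>.symm.trans (by simp)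
  have h : 2 * density G x * fderiv ℝ (density G) x e =
      density G x ^ 2 * ∑ i, ∑ j, (gram G x)⁻¹ j i * fderiv ℝ G x e (frame i) (frame j) := by
    rw [hG.fderiv_density hx e, hsq, Finset.mul_sum]
    refine Finset.sum_congr rfl fun i _ => ?_
    rw [Finset.mul_sum]
    refine Finset.sum_congr rfl fun j _ => ?_
    rw [Matrix.inv_def, Ring.inverse_eq_inv', Matrix.smul_apply, smul_eq_mul]
    have := (hG.det_gram_pos hx).ne'
    field_simp
  have h2 : traceE3 (christoffelMap G x e) =
      (∑ i, ∑ j, (gram G x)⁻¹ j i * fderiv ℝ G x e (frame i) (frame j)) / 2 := by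
    simp only [traceE3, christoffelMap_apply, christoffel_apply, Fin.sum_univ_three]
    rw [hsymm 1 0, hsymm 2 0, hsymm 2 1]
    simp only [hG.fderiv_symm hx _ (frame _) e]
    ring
  rw [h2]
  have := hρ.ne'
  apply mul_left_cancel₀ (mul_ne_zero two_ne_zero this)
  rw [h]
  ring

/-- This is `L_S vol = 0`, obtained as the trace of the Killing equation against the inverse metric.
-/
theorem fderiv_density_of_killing {S : E3 → E3} (hS : KillingEquationOn U G S) {x : E3}
    (hx : x ∈ U) :
    fderiv ℝ (density G) x (S x) + density G x * traceE3 (fderiv ℝ S x) = 0 := by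
  have hρ := (hG.density_pos hx).ne'
  have hsq : density G x ^ 2 = (gram G x).det := Real.sq_sqrt (hG.det_gram_pos hx).le
  have h : ∀ i j, fderiv ℝ G x (S x) (frame i) (frame j) =
      - ∑ k, fderiv ℝ S x (frame i) k * gram G x k j
      - ∑ k, fderiv ℝ S x (frame j) k * gram G x k i := by
    intro i j
    have := hS x hx (frame i) (frame j)
    rw [map_eq_sum_frame (G x) (fderiv ℝ S x (frame i)), hG.symm x (frame i),
      map_eq_sum_frame (G x) (fderiv ℝ S x (frame j))] at this
    simp only [add_apply, smul_apply, smul_eq_mul] at this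
    simp only [Fin.sum_univ_three, gram_apply]
    linarith
  have hs : ∀ i j, gram G x i j = gram G x j i := fun i j => hG.symm x _ _
  have h2 := hG.fderiv_density hx (S x)
  -- Multiplying by twice the density replaces square roots and inverses by `det g` and the
  -- adjugate, leaving a polynomial identity in the `g_ij` and the entries of `DS`.
  apply mul_left_cancel₀ (mul_ne_zero two_ne_zero hρ)
  have h3 : 2 * density G x * (density G x * traceE3 (fderiv ℝ S x)) =
      2 * (gram G x).det * traceE3 (fderiv ℝ S x) := by rw [← hsq]; ring
  rw [mul_add, h2, mul_zero, h3]
  simp only [h, Matrix.adjugate_fin_three, Matrix.det_fin_three, Fin.sum_univ_three, traceE3,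
    hs 1 0, hs 2 0, hs 2 1]
  simp
  ring

end IsMetricOn

/-! ### Contraction, Lie derivative and lift of forms. -/

section Forms

theorem differentiableAt_clm_apply_apply {D A E B : Type*} [NormedAddCommGroup D] [NormedSpace ℝ D]
    [NormedAddCommGroup E] [NormedSpace ℝ E] [NormedAddCommGroup A] [NormedSpace ℝ A]
    [NormedAddCommGroup B] [NormedSpace ℝ B] (c : A →L[ℝ] E →L[ℝ] B) {f : D → A} {g : D → E} {x : D}
    (hf : DifferentiableAt ℝ f x) (hg : DifferentiableAt ℝ g x) :
    DifferentiableAt ℝ (fun y => c (f y) (g y)) x :=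
  (c.differentiableAt.comp x hf).clm_apply hg

theorem contDiffOn_clm_apply_apply {D A E B : Type*} [NormedAddCommGroup D] [NormedSpace ℝ D]
    [NormedAddCommGroup E] [NormedSpace ℝ E] [NormedAddCommGroup A] [NormedSpace ℝ A]
    [NormedAddCommGroup B] [NormedSpace ℝ B] (c : A →L[ℝ] E →L[ℝ] B) {f : D → A} {g : D → E}
    {s : Set D} (hf : ContDiffOn ℝ ∞ f s) (hg : ContDiffOn ℝ ∞ g s) :
    ContDiffOn ℝ ∞ (fun y => c (f y) (g y)) s :=
  (c.contDiff.comp_contDiffOn hf).clm_apply hg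

theorem two_form_swap {E : Type*} [NormedAddCommGroup E] [NormedSpace ℝ E]
    (B : E [⋀^Fin 2]→L[ℝ] ℝ) (a b : E) : B ![a, b] = - B ![b, a] := by
  have h := B.toAlternatingMap.map_swap ![b, a] (show (0 : Fin 2) ≠ 1 by decide)
  have h1 : ![b, a] ∘ Equiv.swap (0 : Fin 2) 1 = ![a, b] := by
    ext i : 1
    fin_cases i <;> simp
  rwa [h1] at h

theorem two_form_self {E : Type*} [NormedAddCommGroup E] [NormedSpace ℝ E]
    (B : E [⋀^Fin 2]→L[ℝ] ℝ) (a : E) : B ![a, a] = 0 :=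
  B.map_eq_zero_of_eq _ (i := 0) (j := 1) rfl (by decide)

variable {U : Set E3} {p : TM} {X : TM → TM}

theorem differentiableAt_contract {n : ℕ} {η : Form (n + 1)} (hη : DifferentiableAt ℝ η p)
    (hX : DifferentiableAt ℝ X p) : DifferentiableAt ℝ (contract X η) p :=
  differentiableAt_clm_apply_apply
    (ContinuousAlternatingMap.curryLeftLI (𝕜 := ℝ) (E := TM) (F := ℝ) (n := n)).toContinuousLinearMap
    hη hX

theorem smoothOver_contract {n : ℕ} {η : Form (n + 1)} (hη : SmoothOver U η)
    (hX : SmoothOver U X) : SmoothOver U (contract X η) :=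
  contDiffOn_clm_apply_apply
    (ContinuousAlternatingMap.curryLeftLI (𝕜 := ℝ) (E := TM) (F := ℝ) (n := n)).toContinuousLinearMap
    hη hX

theorem isOpen_prod_univ (hU : IsOpen U) : IsOpen (U ×ˢ (Set.univ : Set E3)) := hU.prod isOpen_univ

theorem CMCNoether.SmoothOver.differentiableAt {V : Type*} [NormedAddCommGroup V] [NormedSpace ℝ V]
    {f : TM → V} (hf : SmoothOver U f) (hU : IsOpen U) (hp : p.1 ∈ U) : DifferentiableAt ℝ f p :=
  (ContDiffOn.contDiffAt hf ((isOpen_prod_univ hU).mem_nhds ⟨hp, trivial⟩)).differentiableAt (by simp)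

theorem CMCNoether.SmoothOver.comp_fst {V : Type*} [NormedAddCommGroup V] [NormedSpace ℝ V]
    {f : E3 → V} (hf : ContDiffOn ℝ ∞ f U) : SmoothOver U fun q => f q.1 :=
  hf.comp contDiff_fst.contDiffOn fun _ hq => hq.1

theorem fderiv_form_apply {E : Type*} [NormedAddCommGroup E] [NormedSpace ℝ E] {n : ℕ}
    {η : E → E [⋀^Fin n]→L[ℝ] ℝ} {x : E} (hη : DifferentiableAt ℝ η x) (w : E) (v : Fin n → E) :
    fderiv ℝ η x w v = fderiv ℝ (fun y => η y v) x w :=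
  (fderiv_continuousAlternatingMap_apply_const_apply hη v w).symm

theorem contract_apply_two (X : TM → TM) (η : Form 3) (p a b : TM) :
    contract X η p ![a, b] = η p ![X p, a, b] := rfl

theorem fderiv_contract_apply {η : Form 2} (hη : DifferentiableAt ℝ η p)
    (hX : DifferentiableAt ℝ X p) (a b : TM) :
    fderiv ℝ (contract X η) p a ![b] = fderiv ℝ η p a ![X p, b] + η p ![fderiv ℝ X p a, b] := by
  rw [fderiv_form_apply (differentiableAt_contract hη hX)]
  have hg : ∀ i, DifferentiableAt ℝ ((![X, fun _ => b] : Fin 2 → TM → TM) i) p := by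
    intro i
    fin_cases i
    · exact hX
    · exact differentiableAt_const b
  have h := fderiv_continuousAlternatingMap_apply_apply (g := ![X, fun _ => b]) hη hg a
  have h1 : ∀ q, (fun i => (![X, fun _ => b] : Fin 2 → TM → TM) i q) = ![X q, b] := by
    intro q; ext i : 1; fin_cases i <;> rfl
  have h2 : ∀ v, Function.update ![X p, b] 0 v = ![v, b] := by
    intro v; ext i : 1; fin_cases i <;> rfl
  simp only [h1, Fin.sum_univ_two, h2] at h
  have h3 : η p (Function.update ![X p, b] 1 (fderiv ℝ (fun _ : TM => b) p a)) = 0 :=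
    (η p).map_coord_zero 1 (by simp)
  refine h.trans ?_
  change _ + (_ + η p (Function.update ![X p, b] 1 (fderiv ℝ (fun _ : TM => b) p a))) = _
  rw [h3, add_zero]
  rfl

/-- Cartan's formula in coordinates. -/
theorem lieDeriv_apply {η : Form 2} (hη : DifferentiableAt ℝ η p) (hX : DifferentiableAt ℝ X p)
    (a b : TM) :
    lieDeriv X η p ![a, b] =
      fderiv ℝ η p (X p) ![a, b] + η p ![fderiv ℝ X p a, b] + η p ![a, fderiv ℝ X p b] := by
  have hswap : η p ![fderiv ℝ X p b, a] = - η p ![a, fderiv ℝ X p b] :=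
    two_form_swap _ _ _
  rw [lieDeriv, Pi.add_apply, ContinuousAlternatingMap.add_apply, contract_apply_two,
    extDeriv_apply_two, extDeriv_apply_three, fderiv_contract_apply hη hX,
    fderiv_contract_apply hη hX, hswap]
  ring

theorem extDeriv_liftForm {n : ℕ} {η : E3 → E3 [⋀^Fin n]→L[ℝ] ℝ} (hη : DifferentiableAt ℝ η p.1) :
    extDeriv (liftForm η) p =
      (extDeriv η p.1).compContinuousLinearMap (ContinuousLinearMap.fst ℝ E3 E3) := by
  have h := extDeriv_pullback (r := 2) (f := (Prod.fst : TM → E3)) (x := p) hη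
    contDiff_fst.contDiffAt (by simp)
  simp only [fderiv_fst] at h
  exact h

theorem two_form_apply (B : E3 [⋀^Fin 2]→L[ℝ] ℝ) (u v : E3) :
    B ![u, v] = (u 1 * v 2 - u 2 * v 1) * B ![frame 1, frame 2] +
      (u 2 * v 0 - u 0 * v 2) * B ![frame 2, frame 0] +
      (u 0 * v 1 - u 1 * v 0) * B ![frame 0, frame 1] := by
  have hswap := two_form_swap B
  have hself := two_form_self B
  have hlin : ∀ a b, B ![a, b] =
      a 0 * B ![frame 0, b] + a 1 * B ![frame 1, b] + a 2 * B ![frame 2, b] := by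
    intro a b
    have h := congrArg (fun ζ => ζ ![b]) (map_eq_sum_frame B.curryLeft a)
    simpa using h
  rw [hlin, hswap (frame 0) v, hswap (frame 1) v, hswap (frame 2) v, hlin v, hlin v, hlin v]
  simp only [hself]
  rw [hswap (frame 1) (frame 0), hswap (frame 2) (frame 1), hswap (frame 0) (frame 2)]
  ring

end Forms

/-! ### Derivatives of the two lagrangians, and the equation of a potential vector. -/

section Lagrangians

theorem lagrangian₀_apply (G : E3 → E3 →L[ℝ] E3 →L[ℝ] ℝ) (ε : ℤˣ) (p a b : TM) :
    lagrangian₀ G ε p ![a, b] =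
      ((ε : ℤ) : ℝ) * density G p.1 * detForm ![p.2, a.1, b.1] := by
  rw [← volForm_apply]
  change volForm G ε p.1 (Matrix.vecCons p.2 fun i => (![a, b] i).1) = _
  congr 1
  ext i : 1
  fin_cases i <;> rfl

theorem lagrangian'_apply (G : E3 → E3 →L[ℝ] E3 →L[ℝ] ℝ) (ε : ℤˣ) (Ξ : E3 → E3) (p a b : TM) :
    lagrangian' G ε Ξ p ![a, b] =
      ((ε : ℤ) : ℝ) * density G p.1 * detForm ![Ξ p.1, a.1, b.1] := by
  rw [← volForm_apply]
  change volForm G ε p.1 (Matrix.vecCons (Ξ p.1) fun i => (![a, b] i).1) = _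
  congr 1
  ext i : 1
  fin_cases i <;> rfl

theorem vec_two_eta {α : Type*} (v : Fin 2 → α) : v = ![v 0, v 1] := by
  ext i : 1
  fin_cases i <;> rfl

theorem compContinuousLinearMap_fst_apply_two (B : E3 [⋀^Fin 2]→L[ℝ] ℝ) (a b : TM) :
    B.compContinuousLinearMap (ContinuousLinearMap.fst ℝ E3 E3) ![a, b] = B ![a.1, b.1] := by
  change B (fun i => (![a, b] i).1) = _
  congr 1
  ext i : 1
  fin_cases i <;> rfl

/-- The linear form `w ↦ det(w, u, v)`. -/
noncomputable def detLeft (u v : E3) : E3 →L[ℝ] ℝ :=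
  (ContinuousAlternatingMap.apply ℝ E3 ℝ ![u, v]).comp detForm.curryLeft

theorem detLeft_apply (u v w : E3) : detLeft u v w = detForm ![w, u, v] := rfl

theorem units_int_sq (ε : ℤˣ) : ((ε : ℤ) : ℝ) ^ 2 = 1 := by
  rcases Int.units_eq_one_or ε with rfl | rfl <;> simp

namespace IsMetricOn

variable {U : Set E3} {G : E3 → E3 →L[ℝ] E3 →L[ℝ] ℝ} (hG : IsMetricOn U G)
include hG

theorem smoothOver_lagrangian₀ (ε : ℤˣ) : SmoothOver U (lagrangian₀ G ε) := by
  refine contDiffOn_of_forall_apply fun v => ?_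
  rw [vec_two_eta v]
  simp only [lagrangian₀_apply, detForm_apply]
  have h : ContDiffOn ℝ ∞ (fun p : TM => density G p.1) (U ×ˢ Set.univ) :=
    SmoothOver.comp_fst hG.contDiffOn_density
  fun_prop

theorem smoothOver_lagrangian' (ε : ℤˣ) {Ξ : E3 → E3} (hΞ : ContDiffOn ℝ ∞ Ξ U) :
    SmoothOver U (lagrangian' G ε Ξ) := by
  refine contDiffOn_of_forall_apply fun v => ?_
  rw [vec_two_eta v]
  simp only [lagrangian'_apply, detForm_apply]
  have h : ContDiffOn ℝ ∞ (fun p : TM => density G p.1) (U ×ˢ Set.univ) :=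
    SmoothOver.comp_fst hG.contDiffOn_density
  have h2 : ContDiffOn ℝ ∞ (fun p : TM => Ξ p.1) (U ×ˢ Set.univ) :=
    SmoothOver.comp_fst hΞ
  have h3 : ∀ i, ContDiffOn ℝ ∞ (fun p : TM => Ξ p.1 i) (U ×ˢ Set.univ) := fun i =>
    (contDiffOn_euclidean.1 h2) i
  have h30 := h3 0
  have h31 := h3 1
  have h32 := h3 2
  fun_prop

theorem differentiableAt_density {x : E3} (hx : x ∈ U) : DifferentiableAt ℝ (density G) x :=
  (hG.contDiffOn_density.contDiffAt (hG.isOpen.mem_nhds hx)).differentiableAt (by simp)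

theorem fderiv_lagrangian₀_apply (ε : ℤˣ) {p : TM} (hp : p.1 ∈ U) (w a b : TM) :
    fderiv ℝ (lagrangian₀ G ε) p w ![a, b] = ((ε : ℤ) : ℝ) *
      (fderiv ℝ (density G) p.1 w.1 * detForm ![p.2, a.1, b.1] +
        density G p.1 * detForm ![w.2, a.1, b.1]) := by
  rw [fderiv_form_apply ((hG.smoothOver_lagrangian₀ ε).differentiableAt hG.isOpen hp)]
  simp only [lagrangian₀_apply]
  have h1 : HasFDerivAt (fun q : TM => density G q.1)
      ((fderiv ℝ (density G) p.1).comp (ContinuousLinearMap.fst ℝ E3 E3)) p :=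
    (hG.differentiableAt_density hp).hasFDerivAt.comp p hasFDerivAt_fst
  have h2 : HasFDerivAt (fun q : TM => detForm ![q.2, a.1, b.1])
      ((detLeft a.1 b.1).comp (ContinuousLinearMap.snd ℝ E3 E3)) p :=
    (detLeft a.1 b.1).hasFDerivAt.comp p hasFDerivAt_snd
  rw [((h1.const_mul _).fun_mul h2).fderiv]
  simp only [add_apply, smul_apply, smul_eq_mul, ContinuousLinearMap.comp_apply,
    ContinuousLinearMap.coe_fst', ContinuousLinearMap.coe_snd', detLeft_apply]
  ring

theorem fderiv_lagrangian'_apply (ε : ℤˣ) {Ξ : E3 → E3} (hΞ : ContDiffOn ℝ ∞ Ξ U) {p : TM}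
    (hp : p.1 ∈ U) (w a b : TM) :
    fderiv ℝ (lagrangian' G ε Ξ) p w ![a, b] = ((ε : ℤ) : ℝ) *
      (fderiv ℝ (density G) p.1 w.1 * detForm ![Ξ p.1, a.1, b.1] +
        density G p.1 * detForm ![fderiv ℝ Ξ p.1 w.1, a.1, b.1]) := by
  rw [fderiv_form_apply ((hG.smoothOver_lagrangian' ε hΞ).differentiableAt hG.isOpen hp)]
  simp only [lagrangian'_apply]
  have h1 : HasFDerivAt (fun q : TM => density G q.1)
      ((fderiv ℝ (density G) p.1).comp (ContinuousLinearMap.fst ℝ E3 E3)) p :=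
    (hG.differentiableAt_density hp).hasFDerivAt.comp p hasFDerivAt_fst
  have h2 : HasFDerivAt (fun q : TM => detForm ![Ξ q.1, a.1, b.1])
      ((detLeft a.1 b.1).comp ((fderiv ℝ Ξ p.1).comp (ContinuousLinearMap.fst ℝ E3 E3))) p :=
    (detLeft a.1 b.1).hasFDerivAt.comp p
      (((hΞ.contDiffAt (hG.isOpen.mem_nhds hp)).differentiableAt (by simp)).hasFDerivAt.comp p
        hasFDerivAt_fst)
  rw [((h1.const_mul _).fun_mul h2).fderiv]
  simp only [add_apply, smul_apply, smul_eq_mul, ContinuousLinearMap.comp_apply,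
    ContinuousLinearMap.coe_fst', detLeft_apply]
  ring

theorem smoothOver_extension {S : E3 → E3} (hS : ContDiffOn ℝ ∞ S U) :
    SmoothOver U (extension S) := by
  have h1 : SmoothOver U fun p => fderiv ℝ S p.1 :=
    SmoothOver.comp_fst (hS.fderiv_of_isOpen hG.isOpen (by simp))
  exact (SmoothOver.comp_fst hS).prodMk (ContDiffOn.clm_apply h1 contDiff_snd.contDiffOn)

/-- The lagrangians see only base components of tangent vectors, so this is all of the derivative of
the extension that their Lie derivatives need. -/
theorem fderiv_extension_fst {S : E3 → E3} (hS : ContDiffOn ℝ ∞ S U) {p : TM} (hp : p.1 ∈ U)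
    (w : TM) : (fderiv ℝ (extension S) p w).1 = fderiv ℝ S p.1 w.1 := by
  have h1 := ((hG.smoothOver_extension hS).differentiableAt hG.isOpen hp).hasFDerivAt.fst
  have h2 : HasFDerivAt (fun q : TM => S q.1)
      ((fderiv ℝ S p.1).comp (ContinuousLinearMap.fst ℝ E3 E3)) p :=
    ((hS.contDiffAt (hG.isOpen.mem_nhds hp)).differentiableAt (by simp)).hasFDerivAt.comp p
      hasFDerivAt_fst
  exact congrArg (fun A => A w) (h1.unique h2)

/-- The area lagrangian is invariant under Killing fields. -/
theorem lieDeriv_lagrangian₀ (ε : ℤˣ) {S : E3 → E3} (hS : ContDiffOn ℝ ∞ S U)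
    (hK : KillingEquationOn U G S) {p : TM} (hp : p.1 ∈ U) :
    lieDeriv (extension S) (lagrangian₀ G ε) p = 0 := by
  ext v
  rw [vec_two_eta v, lieDeriv_apply ((hG.smoothOver_lagrangian₀ ε).differentiableAt hG.isOpen hp)
    ((hG.smoothOver_extension hS).differentiableAt hG.isOpen hp), hG.fderiv_lagrangian₀_apply ε hp,
    lagrangian₀_apply, lagrangian₀_apply, hG.fderiv_extension_fst hS hp,
    hG.fderiv_extension_fst hS hp]
  have h1 := hG.fderiv_density_of_killing hK hp
  have h2 := sum_detForm_eq_trace_mul (fderiv ℝ S p.1) p.2 (v 0).1 (v 1).1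
  simp only [extension, ContinuousAlternatingMap.coe_zero, Pi.zero_apply]
  -- The vertical component `DS e` of the extension supplies the first of the three determinants of
  -- the trace identity, the derivatives of the field the other two; the total is `L_S vol = 0`
  -- evaluated on `e` and the two base vectors.
  linear_combination ((ε : ℤ) : ℝ) * detForm ![p.2, (v 0).1, (v 1).1] * h1 +
    ((ε : ℤ) : ℝ) * density G p.1 * h2

theorem divergence_mul_density {Ξ : E3 → E3} (hΞ : ContDiffOn ℝ ∞ Ξ U) {x : E3} (hx : x ∈ U) :
    density G x * divergence G Ξ x =
      fderiv ℝ (density G) x (Ξ x) + density G x * traceE3 (fderiv ℝ Ξ x) := by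
  have hρ := (hG.density_pos hx).ne'
  have hΞ' := ((hΞ.contDiffAt (hG.isOpen.mem_nhds hx)).differentiableAt (by simp)).hasFDerivAt
  have h : ∀ i, fderiv ℝ (fun y => density G y * Ξ y i) x (frame i) =
      fderiv ℝ (density G) x (frame i) * Ξ x i + density G x * fderiv ℝ Ξ x (frame i) i := by
    intro i
    have h1 : HasFDerivAt (fun y => Ξ y i) ((EuclideanSpace.proj i).comp (fderiv ℝ Ξ x)) x :=
      (EuclideanSpace.proj (𝕜 := ℝ) i).hasFDerivAt.comp x hΞ'
    rw [((hG.differentiableAt_density hx).hasFDerivAt.fun_mul h1).fderiv]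
    simp
    ring
  change density G x * ((density G x)⁻¹ *
    ∑ i, fderiv ℝ (fun y => density G y * Ξ y i) x (frame i)) = _
  rw [mul_inv_cancel_left₀ hρ, map_eq_sum_frame (fderiv ℝ (density G) x) (Ξ x)]
  simp only [h, Fin.sum_univ_three, traceE3, smul_eq_mul]
  ring

/-- The formula `d(Ξ ⌟ vol) = div Ξ · vol`: the derivatives of the density combine through the
vanishing of `4`-forms, those of `Ξ` through the trace. -/
theorem extDeriv_lagrangian' (ε : ℤˣ) {Ξ : E3 → E3} (hΞ : ContDiffOn ℝ ∞ Ξ U) {p : TM}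
    (hp : p.1 ∈ U) (a b c : TM) :
    extDeriv (lagrangian' G ε Ξ) p ![a, b, c] =
      divergence G Ξ p.1 * volForm G ε p.1 ![a.1, b.1, c.1] := by
  have h1 := hG.divergence_mul_density hΞ hp
  have h2 := sum_mul_detForm_eq_zero (fderiv ℝ (density G) p.1) (Ξ p.1) a.1 b.1 c.1
  have h3 := sum_detForm_eq_trace_mul (fderiv ℝ Ξ p.1) a.1 b.1 c.1
  rw [extDeriv_apply_three, hG.fderiv_lagrangian'_apply ε hΞ hp,
    hG.fderiv_lagrangian'_apply ε hΞ hp, hG.fderiv_lagrangian'_apply ε hΞ hp, volForm_apply]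
  simp only [detForm_apply] at h2 h3 ⊢
  linear_combination (-((ε : ℤ) : ℝ)) * h2 + ((ε : ℤ) : ℝ) * density G p.1 * h3 -
    ((ε : ℤ) : ℝ) * (a.1 0 * (b.1 1 * c.1 2 - b.1 2 * c.1 1) - a.1 1 * (b.1 0 * c.1 2 - b.1 2 * c.1 0)
      + a.1 2 * (b.1 0 * c.1 1 - b.1 1 * c.1 0)) * h1

theorem contDiffOn_flatForm {F : E3 → E3} (hF : ContDiffOn ℝ ∞ F U) :
    ContDiffOn ℝ ∞ (flatForm G F) U :=
  contDiffOn_of_forall_apply fun v =>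
    (hG.contDiffOn.clm_apply hF).clm_apply (contDiffOn_const (c := v 0))

theorem smoothOver_liftForm_flatForm {F : E3 → E3} (hF : ContDiffOn ℝ ∞ F U) :
    SmoothOver U (liftForm (flatForm G F)) := by
  refine contDiffOn_of_forall_apply fun v => ?_
  exact SmoothOver.comp_fst (f := fun x => flatForm G F x fun i => (v i).1)
    ((hG.contDiffOn.clm_apply hF).clm_apply contDiffOn_const)

/-- A potential vector `F` of `S` satisfies `d F^♭ = S ⌟ vol_M`, and conversely. -/
theorem curl_eq_iff (ε : ℤˣ) {F : E3 → E3} {x : E3} (hx : x ∈ U) (s : E3) :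
    curl G ε F x = s ↔ ∀ u v, extDeriv (flatForm G F) x ![u, v] = volForm G ε x ![s, u, v] := by
  have hρ := (hG.density_pos hx).ne'
  have hε := units_int_sq ε
  have h1 : ∀ i, curl G ε F x i = (((ε : ℤ) : ℝ) * (density G x)⁻¹) *
    (![extDeriv (flatForm G F) x ![frame 1, frame 2],
       extDeriv (flatForm G F) x ![frame 2, frame 0],
       extDeriv (flatForm G F) x ![frame 0, frame 1]] i) := fun i => rfl
  constructor
  · rintro rfl u v
    rw [two_form_apply, volForm_apply, detForm_apply, h1, h1, h1]
    simp
    field_simp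
    rw [hε]
    ring
  · intro h
    ext i
    rw [h1, h, h, h]
    simp only [volForm_apply, detForm_apply]
    fin_cases i <;> simp [frame] <;> field_simp <;> rw [hε, one_mul]

end IsMetricOn

end Lagrangians

/-! ### Potential vectors, compensators and the divergence symmetry. -/

theorem hasFDerivAt_comp_fst {E F V : Type*} [NormedAddCommGroup E] [NormedSpace ℝ E]
    [NormedAddCommGroup F] [NormedSpace ℝ F] [NormedAddCommGroup V] [NormedSpace ℝ V] {f : E → V}
    {f' : E →L[ℝ] V} {p : E × F} (hf : HasFDerivAt f f' p.1) :
    HasFDerivAt (fun q : E × F => f q.1) (f'.comp (ContinuousLinearMap.fst ℝ E F)) p :=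
  hf.comp p hasFDerivAt_fst

namespace IsMetricOn

variable {U : Set E3} {G : E3 → E3 →L[ℝ] E3 →L[ℝ] ℝ} (hG : IsMetricOn U G)
include hG

theorem divergence_of_killing {S : E3 → E3} (hS : ContDiffOn ℝ ∞ S U)
    (hK : KillingEquationOn U G S) {x : E3} (hx : x ∈ U) : divergence G S x = 0 := by
  have h := hG.divergence_mul_density hS hx
  rw [hG.fderiv_density_of_killing hK hx] at h
  exact (mul_eq_zero.1 h).resolve_left (hG.density_pos hx).ne'

theorem contDiffOn_volForm_curryLeft (ε : ℤˣ) {S : E3 → E3} (hS : ContDiffOn ℝ ∞ S U) :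
    ContDiffOn ℝ ∞ (fun x => (volForm G ε x).curryLeft (S x)) U := by
  refine contDiffOn_of_forall_apply fun v => ?_
  have h : ∀ x, (volForm G ε x).curryLeft (S x) v =
      ((ε : ℤ) : ℝ) * density G x * detLeft (v 0) (v 1) (S x) := by
    intro x
    conv_lhs => rw [vec_two_eta v]
    rfl
  simp only [h]
  exact (contDiffOn_const.mul hG.contDiffOn_density).mul
    ((detLeft (v 0) (v 1)).contDiff.comp_contDiffOn hS)

theorem extDeriv_volForm_curryLeft (ε : ℤˣ) {S : E3 → E3} (hS : ContDiffOn ℝ ∞ S U) {x : E3}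
    (hx : x ∈ U) :
    extDeriv (fun x => (volForm G ε x).curryLeft (S x)) x = divergence G S x • volForm G ε x := by
  ext v
  have hd := ((hG.contDiffOn_volForm_curryLeft ε hS).contDiffAt
    (hG.isOpen.mem_nhds hx)).differentiableAt (by simp)
  -- The formula on the base is read off its lift to the tangent bundle, along the zero section and
  -- on vectors without vertical component.
  have h1 := extDeriv_liftForm (p := (x, 0)) hd
  have h2 := hG.extDeriv_lagrangian' ε hS (p := (x, 0)) hx (v 0, 0) (v 1, 0) (v 2, 0)
  have hv : v = ![v 0, v 1, v 2] := by
    ext i : 1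
    fin_cases i <;> rfl
  rw [lagrangian', h1] at h2
  rw [hv]
  refine Eq.trans ?_ h2
  change _ = extDeriv (fun x => (volForm G ε x).curryLeft (S x)) x fun i => _
  congr 1
  ext i : 1
  fin_cases i <;> rfl

/-- Killing fields have potential vectors on star-shaped domains. -/
theorem exists_isPotentialVector {y : E3} (hy : StarConvex ℝ y U) (ε : ℤˣ) {S : E3 → E3}
    (hS : ContDiffOn ℝ ∞ S U) (hK : KillingEquationOn U G S) :
    ∃ F, IsPotentialVector U G ε S F := by
  obtain ⟨η, hη, hdη⟩ := exists_extDeriv_eq_of_starConvex hG.isOpen hy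
    (hG.contDiffOn_volForm_curryLeft ε hS) fun x hx => by
      rw [hG.extDeriv_volForm_curryLeft ε hS hx, hG.divergence_of_killing hS hK hx, zero_smul]
  have hηv : ∀ v, ContDiffOn ℝ ∞ (fun x => η x v) U := fun v =>
    (ContinuousAlternatingMap.apply ℝ E3 ℝ v).contDiff.comp_contDiffOn hη
  -- Raise the index of the primitive `η`, so that `F^♭ = η` on `U`.
  let F : E3 → E3 := fun x => WithLp.toLp 2 ((gram G x)⁻¹.mulVec fun l => η x ![frame l])
  have hF : ContDiffOn ℝ ∞ F U := by
    refine contDiffOn_euclidean.2 fun i => ?_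
    have h : ContDiffOn ℝ ∞ (fun x => ∑ l, (gram G x)⁻¹ i l * η x ![frame l]) U :=
      ContDiffOn.sum fun l _ => (hG.contDiffOn_inv_gram i l).mul (hηv _)
    exact h
  have hflat : ∀ x ∈ U, flatForm G F x = η x := by
    intro x hx
    ext v
    have hv : v = ![v 0] := by ext i : 1; fin_cases i; rfl
    have h1 : ∀ w : E3, η x ![w] = w 0 * η x ![frame 0] + w 1 * η x ![frame 1]
        + w 2 * η x ![frame 2] := by
      intro w
      have h := congrArg (fun ζ => ζ ![]) (map_eq_sum_frame (η x).curryLeft w)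
      simpa using h
    rw [hv, h1]
    change G x (F x) (v 0) = _
    rw [map_eq_sum_frame (G x (F x))]
    simp only [F, hG.inner_inv_gram_mulVec hx, smul_eq_mul]
  refine ⟨F, hF, fun x hx => (hG.curl_eq_iff ε hx _).2 fun u v => ?_⟩
  have h : extDeriv (flatForm G F) x = extDeriv η x := by
    apply Filter.EventuallyEq.extDeriv_eq
    filter_upwards [hG.isOpen.mem_nhds hx] with z hz using hflat z hz
  rw [h, hdη x hx]
  rfl

theorem hasFDerivAt_inner_self {p : TM} (hp : p.1 ∈ U) :
    HasFDerivAt (fun q : TM => G q.1 q.2 q.2)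
      ((((fderiv ℝ G p.1).flip p.2).flip p.2).comp (ContinuousLinearMap.fst ℝ E3 E3) +
        (2 : ℝ) • (G p.1 p.2).comp (ContinuousLinearMap.snd ℝ E3 E3)) p := by
  have h1 := hasFDerivAt_comp_fst (F := E3) (V := E3 →L[ℝ] E3 →L[ℝ] ℝ) (f := G) (p := p)
    (hG.differentiableAt hp).hasFDerivAt
  convert! (h1.clm_apply hasFDerivAt_snd).clm_apply hasFDerivAt_snd using 1
  ext w
  · simp
  · simp [hG.symm p.1 w p.2]
    ring

theorem mem_unitTangent_iff {p : TM} (hp : p.1 ∈ U) (w : TM) :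
    w ∈ unitTangent G p ↔ fderiv ℝ G p.1 w.1 p.2 p.2 + 2 * G p.1 p.2 w.2 = 0 := by
  rw [unitTangent, Set.mem_ofPred_eq, (hG.hasFDerivAt_inner_self hp).fderiv]
  simp

/-- The Killing equation at `u = v = e` says that the extension annihilates `⟨e, e⟩`. -/
theorem isFieldOnUnitBundle_extension {S : E3 → E3} (hS : ContDiffOn ℝ ∞ S U)
    (hK : KillingEquationOn U G S) : IsFieldOnUnitBundle U G (extension S) := by
  refine ⟨hG.smoothOver_extension hS, fun p hp => ?_⟩
  rw [hG.mem_unitTangent_iff hp.1]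
  have h := hK p.1 hp.1 p.2 p.2
  rw [hG.symm p.1 (fderiv ℝ S p.1 p.2)] at h
  simp only [extension]
  linarith

variable (ε : ℤˣ) (H : ℝ) {Ξ S F : E3 → E3}

theorem smoothOver_compensator (hΞ : ContDiffOn ℝ ∞ Ξ U) (hS : ContDiffOn ℝ ∞ S U)
    (hF : ContDiffOn ℝ ∞ F U) :
    SmoothOver U ((2 * H) • (contract (extension S) (lagrangian' G ε Ξ)
      + liftForm (flatForm G F))) :=
  ContDiffOn.const_smul (2 * H) (ContDiffOn.add
    (smoothOver_contract (hG.smoothOver_lagrangian' ε hΞ) (hG.smoothOver_extension hS))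
    (hG.smoothOver_liftForm_flatForm hF))

/-- The Lie derivative of the lagrangian along a Killing field is the exterior derivative of the
compensator. -/
theorem lieDeriv_lagrangian (hΞ : IsVolumeField U G Ξ) (hS : ContDiffOn ℝ ∞ S U)
    (hK : KillingEquationOn U G S) (hF : IsPotentialVector U G ε S F) {p : TM} (hp : p.1 ∈ U) :
    lieDeriv (extension S) (lagrangian G ε H Ξ) p =
      extDeriv ((2 * H) • (contract (extension S) (lagrangian' G ε Ξ)
        + liftForm (flatForm G F))) p := by
  have hX := (hG.smoothOver_extension hS).differentiableAt hG.isOpen hp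
  have h0 := (hG.smoothOver_lagrangian₀ ε).differentiableAt hG.isOpen hp
  have h' := (hG.smoothOver_lagrangian' ε hΞ.1).differentiableAt hG.isOpen hp
  have hflat : DifferentiableAt ℝ (liftForm (flatForm G F)) p :=
    (hG.smoothOver_liftForm_flatForm hF.1).differentiableAt hG.isOpen hp
  have hd : DifferentiableAt ℝ (flatForm G F) p.1 := ((hG.contDiffOn_flatForm hF.1).contDiffAt
    (hG.isOpen.mem_nhds hp)).differentiableAt (by simp)
  have hsplit : lieDeriv (extension S) (lagrangian G ε H Ξ) p =
      lieDeriv (extension S) (lagrangian₀ G ε) p +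
        (2 * H) • lieDeriv (extension S) (lagrangian' G ε Ξ) p := by
    have e1 : contract (extension S) (lagrangian G ε H Ξ) =
        contract (extension S) (lagrangian₀ G ε) +
          (2 * H) • contract (extension S) (lagrangian' G ε Ξ) := rfl
    have e2 : extDeriv (lagrangian G ε H Ξ) p = extDeriv (lagrangian₀ G ε) p +
        (2 * H) • extDeriv (lagrangian' G ε Ξ) p := by
      rw [lagrangian, extDeriv_add h0 (h'.const_smul _), extDeriv_smul]
    simp only [lieDeriv, Pi.add_apply]
    rw [e1, extDeriv_add (differentiableAt_contract h0 hX)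
      ((differentiableAt_contract h' hX).const_smul _), extDeriv_smul]
    simp only [contract, e2, ContinuousAlternatingMap.curryLeft_add,
      ContinuousAlternatingMap.curryLeft_smul, add_apply, smul_apply, smul_add]
    abel
  rw [hsplit, hG.lieDeriv_lagrangian₀ ε hS hK hp, zero_add, extDeriv_smul,
    extDeriv_add (differentiableAt_contract h' hX) hflat]
  congr 1
  rw [lieDeriv, Pi.add_apply]
  congr 1
  -- The terms `d(S ⌟ Λ')` have been cancelled; what is left is `S ⌟ dΛ' = S ⌟ vol = dF^♭`.
  ext v
  rw [vec_two_eta v, contract_apply_two, hG.extDeriv_lagrangian' ε hΞ.1 hp, hΞ.2 _ hp, one_mul,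
    extDeriv_liftForm hd, compContinuousLinearMap_fst_apply_two]
  exact ((hG.curl_eq_iff ε hp _).1 (hF.2 _ hp) _ _).symm

/-- The congruence is an equality over `U`, even before restriction to `𝒞`, so both contact
coefficients are zero. -/
theorem isCompensator (hΞ : IsVolumeField U G Ξ) (hS : ContDiffOn ℝ ∞ S U)
    (hK : KillingEquationOn U G S) (hF : IsPotentialVector U G ε S F) :
    IsCompensator U G ε H Ξ (extension S) ((2 * H) • (contract (extension S) (lagrangian' G ε Ξ)
      + liftForm (flatForm G F))) := by
  refine ⟨hG.smoothOver_compensator ε H hΞ.1 hS hF.1, 0, 0, contDiffOn_const, contDiffOn_const,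
    fun p hp w _ w' _ => ?_⟩
  rw [Pi.sub_apply, hG.lieDeriv_lagrangian ε H hΞ hS hK hF hp.1, sub_self]
  simp

theorem isDivergenceSymmetry {y : E3} (hy : StarConvex ℝ y U) (hΞ : IsVolumeField U G Ξ)
    (hS : ContDiffOn ℝ ∞ S U) (hK : KillingEquationOn U G S) :
    IsDivergenceSymmetry U G ε H Ξ (extension S) := by
  obtain ⟨F, hF⟩ := hG.exists_isPotentialVector hy ε hS hK
  obtain ⟨h1, α, a, hα, ha, h2⟩ := hG.isCompensator ε H hΞ hS hK hF
  refine ⟨hG.isFieldOnUnitBundle_extension hS hK, _, h1, α, a, 0, hα, ha, contDiffOn_const,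
    fun p hp w hw w' hw' => ?_⟩
  rw [h2 p hp w hw w' hw']
  simp

end IsMetricOn

/-! ### The structure equation and the conservation law. -/

theorem CMCNoether.SmoothOver.fderiv_apply {V : Type*} [NormedAddCommGroup V] [NormedSpace ℝ V]
    {U : Set E3} (hU : IsOpen U) {f : E3 → V} (hf : ContDiffOn ℝ ∞ f U) {a : TM → E3}
    (ha : SmoothOver U a) : SmoothOver U fun p => fderiv ℝ f p.1 (a p) := by
  have h : SmoothOver U fun p => fderiv ℝ f p.1 :=
    SmoothOver.comp_fst (hf.fderiv_of_isOpen hU (by simp))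
  exact ContDiffOn.clm_apply h ha

theorem contactForm_apply (G : E3 → E3 →L[ℝ] E3 →L[ℝ] ℝ) (p w : TM) :
    contactForm G p ![w] = G p.1 p.2 w.1 := rfl

theorem eulerLagrange_apply (G : E3 → E3 →L[ℝ] E3 →L[ℝ] ℝ) (ε : ℤˣ) (H : ℝ) (p a b : TM) :
    eulerLagrange G ε H p a b = ((ε : ℤ) : ℝ) * density G p.1 *
      (detForm ![p.2, verticalPart G p a, b.1] + detForm ![p.2, a.1, verticalPart G p b] +
        2 * H * detForm ![p.2, a.1, b.1]) := by
  rw [eulerLagrange, eulerLagrange₀, lagrangian₀_apply, volForm_apply, volForm_apply]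
  ring

/-- The contraction of the Euler-Lagrange operator with a vector field. -/
noncomputable def contractEulerLagrange (G : E3 → E3 →L[ℝ] E3 →L[ℝ] ℝ) (ε : ℤˣ) (H : ℝ)
    (X : TM → TM) : Form 1 := fun p =>
  ContinuousAlternatingMap.ofSubsingleton ℝ TM ℝ (0 : Fin 1)
    ((((ε : ℤ) : ℝ) * density G p.1) •
      ((detLeft p.2 (verticalPart G p (X p))).comp (ContinuousLinearMap.fst ℝ E3 E3) +
        (detLeft p.2 (X p).1).comp (ContinuousLinearMap.snd ℝ E3 E3 +
          (christoffelMap G p.1 p.2).comp (ContinuousLinearMap.fst ℝ E3 E3)) +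
        (2 * H) • (detLeft p.2 (X p).1).comp (ContinuousLinearMap.fst ℝ E3 E3)))

theorem contractEulerLagrange_apply (G : E3 → E3 →L[ℝ] E3 →L[ℝ] ℝ) (ε : ℤˣ) (H : ℝ)
    (X : TM → TM) (p w : TM) :
    contractEulerLagrange G ε H X p ![w] = eulerLagrange G ε H p (X p) w := by
  have hcyc : ∀ a b c : E3, detForm ![c, a, b] = detForm ![a, b, c] := fun a b c => by
    simp only [detForm_apply]
    ring
  have h : contractEulerLagrange G ε H X p ![w] = ((ε : ℤ) : ℝ) * density G p.1 *
      (detLeft p.2 (verticalPart G p (X p)) w.1 + detLeft p.2 (X p).1 (verticalPart G p w) +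
        2 * H * detLeft p.2 (X p).1 w.1) := rfl
  rw [h, eulerLagrange_apply]
  simp only [detLeft_apply]
  rw [hcyc p.2 (verticalPart G p (X p)) w.1, hcyc p.2 (X p).1 w.1,
    hcyc p.2 (X p).1 (verticalPart G p w)]

namespace IsMetricOn

variable {U : Set E3} {G : E3 → E3 →L[ℝ] E3 →L[ℝ] ℝ} (hG : IsMetricOn U G)
include hG

theorem smoothOver_christoffel {u v : TM → E3} (hu : SmoothOver U u) (hv : SmoothOver U v) :
    SmoothOver U fun p => christoffel G p.1 (u p) (v p) := by
  refine contDiffOn_euclidean.2 fun i => ?_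
  simp only [christoffel_apply]
  have hd' : ∀ {a b c : TM → E3}, SmoothOver U a → SmoothOver U b → SmoothOver U c →
      SmoothOver U fun p => fderiv ℝ G p.1 (a p) (b p) (c p) := fun ha hb hc =>

    ContDiffOn.clm_apply (ContDiffOn.clm_apply
      (CMCNoether.SmoothOver.fderiv_apply hG.isOpen hG.contDiffOn ha) hb) hc
  have hf : ∀ l, SmoothOver U fun _ => frame l := fun l => contDiffOn_const
  refine ContDiffOn.sum fun l _ => ContDiffOn.mul
    (SmoothOver.comp_fst (hG.contDiffOn_inv_gram i l)) (ContDiffOn.div_const ?_ 2)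
  exact ((hd' hu hv (hf l)).add (hd' hv hu (hf l))).sub (hd' (hf l) hu hv)

theorem smoothOver_contractEulerLagrange (ε : ℤˣ) (H : ℝ) {X : TM → TM} (hX : SmoothOver U X) :
    SmoothOver U (contractEulerLagrange G ε H X) := by
  refine contDiffOn_of_forall_apply fun v => ?_
  have hv : v = ![v 0] := by ext i : 1; fin_cases i; rfl
  rw [hv]
  simp only [contractEulerLagrange_apply, eulerLagrange_apply]
  have hX1 : SmoothOver U fun p => (X p).1 := ContDiffOn.fst hX
  have hX2 : SmoothOver U fun p => (X p).2 := ContDiffOn.snd hX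
  have he : SmoothOver U fun p => p.2 := contDiff_snd.contDiffOn
  have hc : ∀ u : E3, SmoothOver U fun _ => u := fun u => contDiffOn_const
  have hvX : SmoothOver U fun p => verticalPart G p (X p) :=
    ContDiffOn.add hX2 (hG.smoothOver_christoffel hX1 he)
  have hvv : SmoothOver U fun p => verticalPart G p (v 0) :=
    ContDiffOn.add (hc _) (hG.smoothOver_christoffel (hc _) he)
  have hρ : SmoothOver U fun p => density G p.1 := SmoothOver.comp_fst hG.contDiffOn_density
  have hdet : ∀ {a b c : TM → E3}, SmoothOver U a → SmoothOver U b → SmoothOver U c →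
      SmoothOver U fun p => detForm ![a p, b p, c p] := by
    intro a b c ha hb hc
    have ha' := fun i => contDiffOn_euclidean.1 ha i
    have hb' := fun i => contDiffOn_euclidean.1 hb i
    have hc' := fun i => contDiffOn_euclidean.1 hc i
    simp only [detForm_apply]
    exact (((ha' 0).mul (((hb' 1).mul (hc' 2)).sub ((hb' 2).mul (hc' 1)))).sub
      ((ha' 1).mul (((hb' 0).mul (hc' 2)).sub ((hb' 2).mul (hc' 0))))).add
      ((ha' 2).mul (((hb' 0).mul (hc' 1)).sub ((hb' 1).mul (hc' 0))))
  exact (contDiffOn_const.mul hρ).mul (((hdet he hvX (hc _)).add (hdet he hX1 hvv)).add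
    (contDiffOn_const.mul (hdet he hX1 (hc _))))

theorem smoothOver_inner {u v : TM → E3} (hu : SmoothOver U u) (hv : SmoothOver U v) :
    SmoothOver U fun p => G p.1 (u p) (v p) :=
  ContDiffOn.clm_apply (ContDiffOn.clm_apply (SmoothOver.comp_fst hG.contDiffOn) hu) hv

/-- The covariant form of `dΛ₀`. The derivatives of the density add up to its derivative along `e`
times the determinant of the base vectors; by `trace_christoffelMap` this is exactly what the
Christoffel terms of the vertical parts produce. -/
theorem extDeriv_lagrangian₀ (ε : ℤˣ) {p : TM} (hp : p.1 ∈ U) (a b c : TM) :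
    extDeriv (lagrangian₀ G ε) p ![a, b, c] = ((ε : ℤ) : ℝ) * density G p.1 *
      (detForm ![verticalPart G p a, b.1, c.1] + detForm ![a.1, verticalPart G p b, c.1] +
        detForm ![a.1, b.1, verticalPart G p c]) := by
  have h1 := sum_mul_detForm_eq_zero (fderiv ℝ (density G) p.1) p.2 a.1 b.1 c.1
  have h2 := sum_detForm_eq_trace_mul (christoffelMap G p.1 p.2) a.1 b.1 c.1
  have h3 := hG.trace_christoffelMap hp p.2
  rw [extDeriv_apply_three, hG.fderiv_lagrangian₀_apply ε hp, hG.fderiv_lagrangian₀_apply ε hp,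
    hG.fderiv_lagrangian₀_apply ε hp]
  simp only [christoffelMap_apply] at h2
  simp only [verticalPart, detForm_apply, PiLp.add_apply] at h1 h2 ⊢
  linear_combination (-((ε : ℤ) : ℝ)) * h1 - ((ε : ℤ) : ℝ) * density G p.1 * h2 -
    ((ε : ℤ) : ℝ) * (a.1 0 * (b.1 1 * c.1 2 - b.1 2 * c.1 1) - a.1 1 * (b.1 0 * c.1 2 - b.1 2 * c.1 0)
      + a.1 2 * (b.1 0 * c.1 1 - b.1 1 * c.1 0)) * h3

/-- Compatibility of the connection with the metric: differentiating `⟨e, e⟩ = 1` gives `⟨e, ∇e⟩ =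
0`. -/
theorem inner_verticalPart {p : TM} (hp : p.1 ∈ U) {w : TM} (hw : w ∈ unitTangent G p) :
    G p.1 p.2 (verticalPart G p w) = 0 := by
  rw [hG.mem_unitTangent_iff hp] at hw
  rw [verticalPart, map_add, hG.symm p.1 p.2 (christoffel G p.1 w.1 p.2),
    hG.inner_christoffel hp]
  linarith

/-- The structure equation `d(Λ₀ + 2HΛ') = θ⁰ ∧ Ψ` on the unit tangent bundle. -/
theorem extDeriv_lagrangian_eq (ε : ℤˣ) (H : ℝ) {p : TM} (hp : p ∈ unitBundle U G) {a b c : TM}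
    (ha : a ∈ unitTangent G p) (hb : b ∈ unitTangent G p) (hc : c ∈ unitTangent G p) :
    extDeriv (lagrangian₀ G ε) p ![a, b, c] + 2 * H * volForm G ε p.1 ![a.1, b.1, c.1] =
      contactForm G p ![a] * eulerLagrange G ε H p b c
        - contactForm G p ![b] * eulerLagrange G ε H p a c
        + contactForm G p ![c] * eulerLagrange G ε H p a b := by
  have ha' := hG.inner_verticalPart hp.1 ha
  have hb' := hG.inner_verticalPart hp.1 hb
  have hc' := hG.inner_verticalPart hp.1 hc
  -- With `⟨e, e⟩ = 1`, each identity expands a determinant of three vectors into determinants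
  -- containing `e`, weighted by scalar products with `e`. These weights are values of `θ⁰` on base
  -- components and zero on vertical parts.
  have h0 := sum_mul_detForm_eq_zero (G p.1 p.2) p.2 a.1 b.1 c.1
  have h1 := sum_mul_detForm_eq_zero (G p.1 p.2) p.2 (verticalPart G p a) b.1 c.1
  have h2 := sum_mul_detForm_eq_zero (G p.1 p.2) p.2 a.1 (verticalPart G p b) c.1
  have h3 := sum_mul_detForm_eq_zero (G p.1 p.2) p.2 a.1 b.1 (verticalPart G p c)
  rw [hp.2] at h0 h1 h2 h3
  rw [ha'] at h1
  rw [hb'] at h2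
  rw [hc'] at h3
  rw [hG.extDeriv_lagrangian₀ ε hp.1]
  simp only [contactForm_apply, eulerLagrange_apply, volForm_apply]
  linear_combination ((ε : ℤ) : ℝ) * density G p.1 * (h1 + h2 + h3 + 2 * H * h0)

/-- Contract the structure equation with the extension of `S`, using `d(S ⌟ Λ₀) = -S ⌟ dΛ₀` and
`dF^♭ = S ⌟ vol`. The coefficients are `S ⌟ Ψ` along `θ⁰`, zero along `dθ⁰` and `-θ⁰(S)` along `Ψ`.
-/
theorem isConservationLaw (ε : ℤˣ) (H : ℝ) {S F : E3 → E3} (hS : ContDiffOn ℝ ∞ S U)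
    (hK : KillingEquationOn U G S) (hF : IsPotentialVector U G ε S F) :
    IsConservationLaw U G ε H (noetherExpr G ε H (extension S) F) := by
  have hX := hG.smoothOver_extension hS
  have h0 := hG.smoothOver_lagrangian₀ ε
  have hflat := hG.smoothOver_liftForm_flatForm hF.1
  refine ⟨ContDiffOn.sub (smoothOver_contract h0 hX) (ContDiffOn.const_smul (2 * H) hflat),
    contractEulerLagrange G ε H (extension S), 0, fun p => - G p.1 p.2 (S p.1),
    hG.smoothOver_contractEulerLagrange ε H hX, contDiffOn_const,
    ContDiffOn.neg (hG.smoothOver_inner contDiff_snd.contDiffOn (SmoothOver.comp_fst hS)),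
    fun p hp w hw w' hw' => ?_⟩
  have hXp := hX.differentiableAt hG.isOpen hp.1
  have h0p := h0.differentiableAt hG.isOpen hp.1
  have hflatp := hflat.differentiableAt hG.isOpen hp.1
  have hd : DifferentiableAt ℝ (flatForm G F) p.1 := ((hG.contDiffOn_flatForm hF.1).contDiffAt
    (hG.isOpen.mem_nhds hp.1)).differentiableAt (by simp)
  -- Cartan's formula together with `L_S Λ₀ = 0`.
  have h1 : extDeriv (contract (extension S) (lagrangian₀ G ε)) p ![w, w'] =
      - extDeriv (lagrangian₀ G ε) p ![extension S p, w, w'] := by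
    have h := congrArg (fun ζ => ζ ![w, w']) (hG.lieDeriv_lagrangian₀ ε hS hK hp.1)
    exact eq_neg_of_add_eq_zero_left h
  have h2 : extDeriv (noetherExpr G ε H (extension S) F) p =
      extDeriv (contract (extension S) (lagrangian₀ G ε)) p -
        (2 * H) • extDeriv (liftForm (flatForm G F)) p := by
    have h : noetherExpr G ε H (extension S) F = contract (extension S) (lagrangian₀ G ε) +
        (-(2 * H)) • liftForm (flatForm G F) := by
      funext q
      ext v
      simp [noetherExpr, sub_eq_add_neg]
    rw [h, extDeriv_add (differentiableAt_contract h0p hXp) (hflatp.const_smul _), extDeriv_smul,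
      neg_smul, sub_eq_add_neg]
  have h3 := hG.extDeriv_lagrangian_eq ε H hp
    ((hG.isFieldOnUnitBundle_extension hS hK).2 p hp) hw hw'
  have h4 := (hG.curl_eq_iff ε hp.1 _).1 (hF.2 _ hp.1) w.1 w'.1
  have h5 : extDeriv (noetherExpr G ε H (extension S) F) p ![w, w'] =
      extDeriv (contract (extension S) (lagrangian₀ G ε)) p ![w, w'] -
        2 * H * extDeriv (liftForm (flatForm G F)) p ![w, w'] := by
    rw [h2]
    rfl
  rw [h5, h1, extDeriv_liftForm hd, compContinuousLinearMap_fst_apply_two, h4,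
    contractEulerLagrange_apply, contractEulerLagrange_apply]
  simp only [contactForm_apply, extension, Pi.zero_apply] at h3 ⊢
  linear_combination -h3

end IsMetricOn

/-! ### Closed forms: primitives, gluing, and wedge products. -/

section ClosedForms

open Set Topology

/-- Closed `1`-forms on star-shaped open sets are exact. -/
theorem exists_fderiv_eq_of_starConvex {E : Type*} [NormedAddCommGroup E] [NormedSpace ℝ E]
    {U : Set E} (hU : IsOpen U) {y : E} (hy : StarConvex ℝ y U) {η : E → E [⋀^Fin 1]→L[ℝ] ℝ}
    (hη : ContDiffOn ℝ ∞ η U) (hd : ∀ x ∈ U, extDeriv η x = 0) :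
    ∃ f : E → ℝ, ContDiffOn ℝ ∞ f U ∧ ∀ x ∈ U, ∀ w, fderiv ℝ f x w = η x ![w] := by
  obtain ⟨β, hβ, hdβ⟩ := exists_extDeriv_eq_of_starConvex hU hy hη hd
  refine ⟨fun x => β x ![],
    (ContinuousAlternatingMap.apply ℝ E ℝ ![]).contDiff.comp_contDiffOn hβ, fun x hx w => ?_⟩
  have hβx := (hβ.contDiffAt (hU.mem_nhds hx)).differentiableAt (by simp)
  rw [← hdβ x hx, ← fderiv_form_apply hβx]
  have h : Fin.removeNth 0 ![w] = ![] := Subsingleton.elim _ _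
  simp [extDeriv, ContinuousAlternatingMap.alternatizeUncurryFin_apply, h]

/-- Two functions with the same derivative on a preconnected overlap can be glued up to a
constant. -/
theorem exists_glue_of_fderiv_eq {E : Type*} [NormedAddCommGroup E] [NormedSpace ℝ E]
    {A B : Set E} (hA : IsOpen A) (hB : IsOpen B) (hAB : IsPreconnected (A ∩ B)) {f g : E → ℝ}
    (hf : DifferentiableOn ℝ f A) (hg : DifferentiableOn ℝ g B)
    (h : ∀ x ∈ A ∩ B, fderiv ℝ f x = fderiv ℝ g x) :
    ∃ (k : E → ℝ) (c : ℝ), (∀ x ∈ A, k =ᶠ[𝓝 x] f) ∧ ∀ x ∈ B, k =ᶠ[𝓝 x] fun y => g y + c := by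
  classical
  obtain ⟨c, hc⟩ := (hA.inter hB).exists_is_const_of_fderiv_eq_zero (f := fun x => f x - g x) hAB
    ((hf.mono inter_subset_left).sub (hg.mono inter_subset_right)) fun x hx => by
      rw [fderiv_fun_sub (hf.differentiableAt (hA.mem_nhds hx.1))
        (hg.differentiableAt (hB.mem_nhds hx.2)), h x hx, sub_self]
      rfl
  refine ⟨fun x => if x ∈ A then f x else g x + c, c, fun x hx => ?_, fun x hx => ?_⟩
  · filter_upwards [hA.mem_nhds hx] with y hy
    exact if_pos hy
  · filter_upwards [hB.mem_nhds hx] with y hy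
    by_cases hyA : y ∈ A
    · rw [if_pos hyA]
      linarith [hc y ⟨hyA, hy⟩]
    · exact if_neg hyA

/-- If `θ ∧ α` is closed, then `dθ ∧ α` vanishes on the kernel of `θ`. -/
theorem extDeriv_mul_eq_zero_of_wedge_closed {E : Type*} [NormedAddCommGroup E] [NormedSpace ℝ E]
    {θ α : E → E [⋀^Fin 1]→L[ℝ] ℝ} {ζ : E → E [⋀^Fin 2]→L[ℝ] ℝ} {p : E}
    (hθ : DifferentiableAt ℝ θ p) (hα : DifferentiableAt ℝ α p) (hζ : DifferentiableAt ℝ ζ p)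
    (h : ∀ᶠ q in 𝓝 p, ∀ u v, ζ q ![u, v] = θ q ![u] * α q ![v] - θ q ![v] * α q ![u])
    (hd : extDeriv ζ p = 0) {a b c : E} (ha : θ p ![a] = 0) (hb : θ p ![b] = 0)
    (hc : θ p ![c] = 0) :
    extDeriv θ p ![a, b] * α p ![c] - extDeriv θ p ![a, c] * α p ![b] +
      extDeriv θ p ![b, c] * α p ![a] = 0 := by
  have hval : ∀ {η : E → E [⋀^Fin 1]→L[ℝ] ℝ}, DifferentiableAt ℝ η p → ∀ u,
      DifferentiableAt ℝ (fun q => η q ![u]) p := fun hη u =>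
    (ContinuousAlternatingMap.apply ℝ E ℝ ![u]).differentiableAt.comp p hη
  have hD : ∀ w u v, fderiv ℝ ζ p w ![u, v] =
      fderiv ℝ θ p w ![u] * α p ![v] + θ p ![u] * fderiv ℝ α p w ![v] -
        (fderiv ℝ θ p w ![v] * α p ![u] + θ p ![v] * fderiv ℝ α p w ![u]) := by
    intro w u v
    have hev : (fun q => ζ q ![u, v]) =ᶠ[𝓝 p]
        fun q => θ q ![u] * α q ![v] - θ q ![v] * α q ![u] := h.mono fun q hq => hq u v
    rw [fderiv_form_apply hζ, hev.fderiv_eq, fderiv_form_apply hθ, fderiv_form_apply hθ,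
      fderiv_form_apply hα, fderiv_form_apply hα,
      ((((hval hθ u).hasFDerivAt).fun_mul (hval hα v).hasFDerivAt).fun_sub
        (((hval hθ v).hasFDerivAt).fun_mul (hval hα u).hasFDerivAt)).fderiv]
    simp only [sub_apply, add_apply, smul_apply, smul_eq_mul]
    ring
  -- On vectors killed by `θ`, the terms with derivatives of `α` carry a factor `θ` and disappear.
  have h0 := congrArg (fun ξ => ξ ![a, b, c]) hd
  simp only [extDeriv_apply_three, hD, ha, hb, hc] at h0
  rw [extDeriv_apply_two, extDeriv_apply_two, extDeriv_apply_two]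
  simp only [ContinuousAlternatingMap.coe_zero, Pi.zero_apply] at h0
  linear_combination h0

end ClosedForms

/-! ### Exactness of closed `1`-forms on `U × (E3 ∖ {0})`. -/

section Slit

open Set

/-- The complement of a closed half-line in `E3`. -/
def slit (σ : ℝ) : Set E3 := {e | 0 < σ * e 0 ∨ e 1 ≠ 0 ∨ e 2 ≠ 0}

theorem isOpen_slit (σ : ℝ) : IsOpen (slit σ) := by
  have h : ∀ i : Fin 3, Continuous fun e : E3 => e i := fun i => by fun_prop
  exact (isOpen_lt continuous_const (continuous_const.mul (h 0))).union
    ((isOpen_ne_fun (h 1) continuous_const).union (isOpen_ne_fun (h 2) continuous_const))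

/-- The centre lies on the axis, opposite to the removed half-line. Moving towards it scales the
transverse coordinates by a positive factor until the centre itself is reached, and keeps `σ e₀ > 0`
where this holds. -/
theorem starConvex_slit {σ : ℝ} (hσ : σ * σ = 1) : StarConvex ℝ (σ • frame 0) (slit σ) := by
  intro e he a b ha hb hab
  rcases hb.eq_or_lt with rfl | hb
  · left
    have : a = 1 := by linarith
    simp [frame, this, hσ]
  · rcases he with he | he | he
    · left
      simp [frame]
      nlinarith [mul_pos hb he]
    · right; left
      simpa [frame, hb.ne'] using he
    · right; right
      simpa [frame, hb.ne'] using he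

theorem slit_union : slit 1 ∪ slit (-1) = {0}ᶜ := by
  ext e
  constructor
  · rintro (h | h) rfl <;> simp [slit] at h
  · intro he
    by_contra hcon
    simp only [slit, mem_union, mem_ofPred_eq, not_or, not_lt, not_not] at hcon
    refine he ?_
    ext i
    fin_cases i
    · simp; linarith
    · simpa using hcon.1.2.1
    · simpa using hcon.1.2.2

/-- The intersection is the complement of a line, a subspace of codimension two. -/
theorem isPreconnected_slit_inter : IsPreconnected (slit 1 ∩ slit (-1)) := by
  have h : slit 1 ∩ slit (-1) = ((Submodule.span ℝ {frame 0} : Submodule ℝ E3) : Set E3)ᶜ := by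
    ext e
    simp only [slit, mem_inter_iff, mem_ofPred_eq, mem_compl_iff, SetLike.mem_coe,
      Submodule.mem_span_singleton]
    constructor
    · rintro ⟨h1, h2⟩ ⟨a, rfl⟩
      simp [frame] at h1 h2
      linarith
    · intro h
      by_contra hcon
      have h12 : e 1 = 0 ∧ e 2 = 0 := by
        by_contra h'
        have : e 1 ≠ 0 ∨ e 2 ≠ 0 := by tauto
        exact hcon ⟨Or.inr this, Or.inr this⟩
      refine h ⟨e 0, ?_⟩
      ext i
      fin_cases i <;> simp [frame, h12]
  rw [h]
  refine (isConnected_compl_of_one_lt_codim ?_).isPreconnected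
  have h1 := Submodule.finrank_quotient_add_finrank (Submodule.span ℝ {frame 0} : Submodule ℝ E3)
  have h2 : Module.finrank ℝ (Submodule.span ℝ {frame 0} : Submodule ℝ E3) = 1 :=
    finrank_span_singleton (by simp [frame])
  rw [h2] at h1
  simp at h1
  rw [← Module.finrank_eq_rank, show Module.finrank ℝ (E3 ⧸ Submodule.span ℝ {frame 0}) = 2 by omega]
  norm_num

theorem starConvex_prod {E F : Type*} [NormedAddCommGroup E] [NormedSpace ℝ E]
    [NormedAddCommGroup F] [NormedSpace ℝ F] {s : Set E} {t : Set F} {x : E} {y : F}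
    (hs : StarConvex ℝ x s) (ht : StarConvex ℝ y t) : StarConvex ℝ (x, y) (s ×ˢ t) :=
  fun _ hz _ _ ha hb hab => ⟨hs hz.1 ha hb hab, ht hz.2 ha hb hab⟩

/-- Closed `1`-forms on the product of a star-shaped open set with `E3 ∖ {0}` are exact. -/
theorem exists_fderiv_eq_of_closed_of_ne_zero {U : Set E3} (hU : IsOpen U) {y : E3}
    (hy : StarConvex ℝ y U) (hyU : y ∈ U) {η : Form 1} (hη : ContDiffOn ℝ ∞ η (U ×ˢ {0}ᶜ))
    (hd : ∀ p ∈ U ×ˢ ({0}ᶜ : Set E3), extDeriv η p = 0) :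
    ∃ f : TM → ℝ, ContDiffOn ℝ ∞ f (U ×ˢ {0}ᶜ) ∧
      ∀ p ∈ U ×ˢ ({0}ᶜ : Set E3), ∀ w, fderiv ℝ f p w = η p ![w] := by
  have hpre : IsPreconnected U :=
    ((hy.isPathConnected hyU).isConnected).isPreconnected
  have hsub : ∀ σ, σ * σ = 1 → U ×ˢ slit σ ⊆ U ×ˢ ({0}ᶜ : Set E3) := by
    rintro σ hσ ⟨x, e⟩ ⟨hx, he⟩
    refine ⟨hx, fun h => ?_⟩
    rw [mem_singleton_iff] at h
    subst h
    simp [slit] at he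
  have hex : ∀ σ : ℝ, σ * σ = 1 → ∃ f : TM → ℝ, ContDiffOn ℝ ∞ f (U ×ˢ slit σ) ∧
      ∀ p ∈ U ×ˢ slit σ, ∀ w, fderiv ℝ f p w = η p ![w] := fun σ hσ =>
    exists_fderiv_eq_of_starConvex (hU.prod (isOpen_slit σ))
      (starConvex_prod hy (starConvex_slit hσ)) (hη.mono (hsub σ hσ))
      fun p hp => hd p (hsub σ hσ hp)
  obtain ⟨f, hf, hdf⟩ := hex 1 (by norm_num)
  obtain ⟨g, hg, hdg⟩ := hex (-1) (by norm_num)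
  have hoA := hU.prod (isOpen_slit 1)
  have hoB := hU.prod (isOpen_slit (-1))
  have hinter : (U ×ˢ slit 1) ∩ (U ×ˢ slit (-1)) = U ×ˢ (slit 1 ∩ slit (-1)) := by
    rw [prod_inter_prod, inter_self]
  -- Two primitives suffice, and their overlap is connected, so a single constant reconciles them.
  obtain ⟨k, c, hkf, hkg⟩ := exists_glue_of_fderiv_eq hoA hoB
    (by rw [hinter]; exact hpre.prod isPreconnected_slit_inter)
    (hf.differentiableOn (by simp)) (hg.differentiableOn (by simp))
    fun p hp => ContinuousLinearMap.ext fun w => by rw [hdf p hp.1, hdg p hp.2]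
  have hcover : ∀ p ∈ U ×ˢ ({0}ᶜ : Set E3), p ∈ U ×ˢ slit 1 ∨ p ∈ U ×ˢ slit (-1) := by
    intro p hp
    have h : p.2 ∈ slit 1 ∪ slit (-1) := by rw [slit_union]; exact hp.2
    exact h.imp (fun h => ⟨hp.1, h⟩) fun h => ⟨hp.1, h⟩
  refine ⟨k, fun p hp => ?_, fun p hp w => ?_⟩
  · rcases hcover p hp with h | h
    · exact ((hf.contDiffAt (hoA.mem_nhds h)).congr_of_eventuallyEq (hkf p h)).contDiffWithinAt
    · exact (((hg.contDiffAt (hoB.mem_nhds h)).add contDiffAt_const).congr_of_eventuallyEq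
        (hkg p h)).contDiffWithinAt
  · rcases hcover p hp with h | h
    · rw [(hkf p h).fderiv_eq, hdf p h]
    · rw [(hkg p h).fderiv_eq, fderiv_add_const, hdg p h]

end Slit

/-! ### Pulling forms back along the radial retraction onto `𝒞`. -/

/-- The radial retraction of the slit tangent bundle onto the unit tangent bundle. -/
noncomputable def unitRetraction (G : E3 → E3 →L[ℝ] E3 →L[ℝ] ℝ) (p : TM) : TM :=
  (p.1, (Real.sqrt (G p.1 p.2 p.2))⁻¹ • p.2)

/-- The pullback of a form along the radial retraction. -/
noncomputable def retractForm (G : E3 → E3 →L[ℝ] E3 →L[ℝ] ℝ) {n : ℕ} (η : Form n) : Form n :=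
  fun p => (η (unitRetraction G p)).compContinuousLinearMap (fderiv ℝ (unitRetraction G) p)

theorem compContinuousLinearMap_apply_one {E : Type*} [NormedAddCommGroup E] [NormedSpace ℝ E]
    (η : E [⋀^Fin 1]→L[ℝ] ℝ) (A : E →L[ℝ] E) (a : E) :
    η.compContinuousLinearMap A ![a] = η ![A a] := by
  change η (fun i => A (![a] i)) = _
  congr 1
  ext i : 1
  fin_cases i
  rfl

theorem compContinuousLinearMap_apply_two {E : Type*} [NormedAddCommGroup E] [NormedSpace ℝ E]
    (η : E [⋀^Fin 2]→L[ℝ] ℝ) (A : E →L[ℝ] E) (a b : E) :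
    η.compContinuousLinearMap A ![a, b] = η ![A a, A b] := by
  change η (fun i => A (![a, b] i)) = _
  congr 1
  ext i : 1
  fin_cases i <;> rfl

theorem contDiffOn_form_apply {D F : Type*} [NormedAddCommGroup D] [NormedSpace ℝ D]
    [NormedAddCommGroup F] [NormedSpace ℝ F] {s : Set D} {n : ℕ} :
    ∀ {η : D → F [⋀^Fin n]→L[ℝ] ℝ} {g : Fin n → D → F}, ContDiffOn ℝ ∞ η s →
      (∀ i, ContDiffOn ℝ ∞ (g i) s) → ContDiffOn ℝ ∞ (fun x => η x fun i => g i x) s := by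
  induction n with
  | zero =>
    intro η g hη _
    have h : ∀ x, (fun i => g i x) = ![] := fun x => Subsingleton.elim _ _
    simp only [h]
    exact (ContinuousAlternatingMap.apply ℝ F ℝ ![]).contDiff.comp_contDiffOn hη
  | succ n ih =>
    intro η g hη hg
    have h1 : ContDiffOn ℝ ∞ (fun x => (η x).curryLeft (g 0 x)) s :=
      contDiffOn_clm_apply_apply
        (ContinuousAlternatingMap.curryLeftLI (𝕜 := ℝ) (E := F) (F := ℝ) (n := n)).toContinuousLinearMap
        hη (hg 0)
    refine (ih h1 fun i => hg i.succ).congr fun x _ => ?_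
    rw [ContinuousAlternatingMap.curryLeft_apply_apply]
    congr 1
    ext i : 1
    refine Fin.cases rfl (fun _ => rfl) i

theorem contDiffOn_compContinuousLinearMap {E F : Type*} [NormedAddCommGroup E] [NormedSpace ℝ E]
    [NormedAddCommGroup F] [NormedSpace ℝ F] [FiniteDimensional ℝ F] {n : ℕ} {s : Set E}
    {η : E → F [⋀^Fin n]→L[ℝ] ℝ} {A : E → F →L[ℝ] F} (hη : ContDiffOn ℝ ∞ η s)
    (hA : ContDiffOn ℝ ∞ A s) :
    ContDiffOn ℝ ∞ (fun x => (η x).compContinuousLinearMap (A x)) s :=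
  contDiffOn_of_forall_apply fun v =>
    contDiffOn_form_apply (g := fun i x => A x (v i)) hη fun _ => hA.clm_apply contDiffOn_const

/-- Dimension count; it provides a nonzero vector orthogonal to two given ones. -/
theorem exists_ne_zero_of_two_forms (A B : E3 →L[ℝ] ℝ) : ∃ v : E3, v ≠ 0 ∧ A v = 0 ∧ B v = 0 := by
  let L : E3 →ₗ[ℝ] (Fin 2 → ℝ) := LinearMap.pi ![A.toLinearMap, B.toLinearMap]
  have h : ¬ Function.Injective L := by
    intro h
    have := LinearMap.finrank_le_finrank_of_injective h
    simp at this
  obtain ⟨v, hv, hne⟩ : ∃ v, L v = 0 ∧ v ≠ 0 := by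
    by_contra hcon
    push Not at hcon
    exact h ((injective_iff_map_eq_zero L).2 hcon)
  exact ⟨v, hne, congrFun hv 0, congrFun hv 1⟩

theorem ne_zero_of_mem_unitBundle {U : Set E3} {G : E3 → E3 →L[ℝ] E3 →L[ℝ] ℝ}
    {p : TM} (hp : p ∈ unitBundle U G) : p ∈ U ×ˢ ({0}ᶜ : Set E3) := by
  refine ⟨hp.1, fun h => ?_⟩
  have h1 := hp.2
  rw [Set.mem_singleton_iff.1 h] at h1
  simp at h1

theorem unitRetraction_of_mem {U : Set E3} {G : E3 → E3 →L[ℝ] E3 →L[ℝ] ℝ}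
    {p : TM} (hp : p ∈ unitBundle U G) : unitRetraction G p = p := by
  simp [unitRetraction, hp.2]

namespace IsMetricOn

open Topology

variable {U : Set E3} {G : E3 → E3 →L[ℝ] E3 →L[ℝ] ℝ} (hG : IsMetricOn U G)
include hG

theorem isOpen_prod_compl : IsOpen (U ×ˢ ({0}ᶜ : Set E3)) := hG.isOpen.prod isOpen_compl_singleton

theorem inner_self_pos {p : TM} (hp : p ∈ U ×ˢ ({0}ᶜ : Set E3)) : 0 < G p.1 p.2 p.2 :=
  hG.pos p.1 hp.1 p.2 hp.2

theorem contDiffOn_unitRetraction : ContDiffOn ℝ ∞ (unitRetraction G) (U ×ˢ {0}ᶜ) := by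
  have h : ContDiffOn ℝ ∞ (fun p : TM => G p.1 p.2 p.2) (U ×ˢ {0}ᶜ) :=
    (hG.smoothOver_inner (u := Prod.snd) (v := Prod.snd) contDiff_snd.contDiffOn
      contDiff_snd.contDiffOn).mono fun p hp => ⟨hp.1, trivial⟩
  exact contDiff_fst.contDiffOn.prodMk (((h.sqrt fun p hp => (hG.inner_self_pos hp).ne').inv
    fun p hp => (Real.sqrt_pos.2 (hG.inner_self_pos hp)).ne').smul contDiff_snd.contDiffOn)

theorem unitRetraction_mem {p : TM} (hp : p ∈ U ×ˢ ({0}ᶜ : Set E3)) :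
    unitRetraction G p ∈ unitBundle U G := by
  have h := hG.inner_self_pos hp
  have h1 := Real.sq_sqrt h.le
  have h2 := (Real.sqrt_pos.2 h).ne'
  refine ⟨hp.1, ?_⟩
  simp only [unitRetraction, map_smul, smul_apply, smul_eq_mul]
  field_simp
  linarith

theorem differentiableAt_unitRetraction {p : TM} (hp : p ∈ U ×ˢ ({0}ᶜ : Set E3)) :
    DifferentiableAt ℝ (unitRetraction G) p :=
  (hG.contDiffOn_unitRetraction.contDiffAt (hG.isOpen_prod_compl.mem_nhds hp)).differentiableAt
    (by simp)

/-- Differentiate `⟨e, e⟩ = 1` along the retraction, whose image is in `𝒞`. -/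
theorem fderiv_unitRetraction_mem {p : TM} (hp : p ∈ U ×ˢ ({0}ᶜ : Set E3)) (w : TM) :
    fderiv ℝ (unitRetraction G) p w ∈ unitTangent G (unitRetraction G p) := by
  have h1 := (hG.hasFDerivAt_inner_self (hG.unitRetraction_mem hp).1).differentiableAt.hasFDerivAt.comp p
    (hG.differentiableAt_unitRetraction hp).hasFDerivAt
  have h2 : ((fun q : TM => G q.1 q.2 q.2) ∘ unitRetraction G) =ᶠ[𝓝 p] fun _ => 1 := by
    filter_upwards [hG.isOpen_prod_compl.mem_nhds hp] with q hq
    exact (hG.unitRetraction_mem hq).2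
  have h3 := (h1.congr_of_eventuallyEq h2.symm).unique (hasFDerivAt_const (1 : ℝ) p)
  exact congrArg (fun A => A w) h3

/-- The derivative of the normalizing factor is proportional to that of `⟨e, e⟩`, which vanishes on
tangent vectors of `𝒞`. -/
theorem fderiv_unitRetraction_of_mem {p : TM} (hp : p ∈ unitBundle U G) {w : TM}
    (hw : w ∈ unitTangent G p) : fderiv ℝ (unitRetraction G) p w = w := by
  have h0 := (hG.hasFDerivAt_inner_self hp.1).differentiableAt.hasFDerivAt
  have hs := (hasDerivAt_inv (by rw [hp.2]; simp)).comp_hasFDerivAt p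
    (h0.sqrt (by rw [hp.2]; exact one_ne_zero))
  have h := (hasFDerivAt_fst (𝕜 := ℝ) (p := p)).prodMk (hs.smul hasFDerivAt_snd)
  change HasFDerivAt (unitRetraction G) _ p at h
  have hw' : fderiv ℝ (fun q : TM => G q.1 q.2 q.2) p w = 0 := hw
  rw [h.fderiv]
  ext i
  · simp
  · simp [hp.2, hw']

theorem contDiffOn_retractForm {n : ℕ} {η : Form n} (hη : SmoothOver U η) :
    ContDiffOn ℝ ∞ (retractForm G η) (U ×ˢ {0}ᶜ) := by
  have h1 : ContDiffOn ℝ ∞ (fun p => η (unitRetraction G p)) (U ×ˢ {0}ᶜ) :=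
    ContDiffOn.comp hη hG.contDiffOn_unitRetraction fun p hp => ⟨hp.1, trivial⟩
  exact contDiffOn_compContinuousLinearMap h1
    (hG.contDiffOn_unitRetraction.fderiv_of_isOpen hG.isOpen_prod_compl (by simp))

/-- Naturality of `d` turns equations known only on `𝒞` and its tangent vectors into equations on
the open set `U × (E3 ∖ {0})` for all vectors, where they may be differentiated again. -/
theorem extDeriv_retractForm {n : ℕ} {η : Form n} (hη : SmoothOver U η) {p : TM}
    (hp : p ∈ U ×ˢ ({0}ᶜ : Set E3)) :
    extDeriv (retractForm G η) p = (extDeriv η (unitRetraction G p)).compContinuousLinearMap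
      (fderiv ℝ (unitRetraction G) p) :=
  extDeriv_pullback (r := ∞) (hη.differentiableAt hG.isOpen hp.1)
    (hG.contDiffOn_unitRetraction.contDiffAt (hG.isOpen_prod_compl.mem_nhds hp))
    (by simp; norm_cast)

theorem retractForm_apply_one {η : Form 1} {p : TM} (hp : p ∈ unitBundle U G) {w : TM}
    (hw : w ∈ unitTangent G p) : retractForm G η p ![w] = η p ![w] := by
  rw [retractForm, compContinuousLinearMap_apply_one, hG.fderiv_unitRetraction_of_mem hp hw,
    unitRetraction_of_mem hp]

end IsMetricOn

/-! ### Nondegeneracy of `dθ⁰` on the contact hyperplanes. -/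

namespace IsMetricOn

open Topology

variable {U : Set E3} {G : E3 → E3 →L[ℝ] E3 →L[ℝ] ℝ} (hG : IsMetricOn U G)
include hG

theorem smoothOver_contactForm : SmoothOver U (contactForm G) := by
  refine contDiffOn_of_forall_apply fun v => ?_
  exact hG.smoothOver_inner (u := Prod.snd) (v := fun _ => (v 0).1) contDiff_snd.contDiffOn
    contDiffOn_const

theorem fderiv_contactForm_apply {p : TM} (hp : p.1 ∈ U) (w a : TM) :
    fderiv ℝ (contactForm G) p w ![a] = fderiv ℝ G p.1 w.1 p.2 a.1 + G p.1 w.2 a.1 := by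
  rw [fderiv_form_apply (hG.smoothOver_contactForm.differentiableAt hG.isOpen hp)]
  simp only [contactForm_apply]
  have h1 := hasFDerivAt_comp_fst (F := E3) (V := E3 →L[ℝ] E3 →L[ℝ] ℝ) (f := G) (p := p)
    (hG.differentiableAt hp).hasFDerivAt
  have h2 := (h1.clm_apply hasFDerivAt_snd).clm_apply (hasFDerivAt_const a.1 p)
  rw [h2.fderiv]
  simp
  ring

/-- `dθ⁰ = ∑ ω^i_0 ∧ θ^i`, by the absence of torsion. -/
theorem extDeriv_contactForm {p : TM} (hp : p.1 ∈ U) (a b : TM) :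
    extDeriv (contactForm G) p ![a, b] =
      G p.1 (verticalPart G p a) b.1 - G p.1 (verticalPart G p b) a.1 := by
  rw [extDeriv_apply_two, hG.fderiv_contactForm_apply hp, hG.fderiv_contactForm_apply hp]
  simp only [verticalPart, map_add, add_apply]
  rw [hG.inner_christoffel hp, hG.inner_christoffel hp, hG.fderiv_symm hp b.1 a.1 p.2,
    hG.fderiv_symm hp a.1 b.1 p.2, hG.fderiv_symm hp p.2 b.1 a.1]
  ring

theorem mem_unitTangent_iff_inner_verticalPart {p : TM} (hp : p.1 ∈ U) (w : TM) :
    w ∈ unitTangent G p ↔ G p.1 p.2 (verticalPart G p w) = 0 := by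
  refine ⟨hG.inner_verticalPart hp, fun h => ?_⟩
  rw [hG.mem_unitTangent_iff hp]
  rw [verticalPart, map_add, hG.symm p.1 p.2 (christoffel G p.1 w.1 p.2),
    hG.inner_christoffel hp] at h
  linarith

omit hG in
/-- The tangent vector at `p` with horizontal part `u` and vertical part `ν`. -/
theorem exists_fst_verticalPart (G : E3 → E3 →L[ℝ] E3 →L[ℝ] ℝ) (p : TM) (u ν : E3) :
    ∃ w : TM, w.1 = u ∧ verticalPart G p w = ν :=
  ⟨(u, ν - christoffel G p.1 u p.2), rfl, by simp [verticalPart]⟩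

/-- If the exterior derivative of `γ` is `θ⁰ ∧ α` on the unit tangent bundle, then it vanishes
there. -/
theorem extDeriv_eq_zero_of_eq_wedge {γ α : Form 1} (hγ : SmoothOver U γ) (hα : SmoothOver U α)
    (h : ∀ p ∈ unitBundle U G, ∀ w ∈ unitTangent G p, ∀ w' ∈ unitTangent G p,
      extDeriv γ p ![w, w'] =
        contactForm G p ![w] * α p ![w'] - contactForm G p ![w'] * α p ![w])
    {p : TM} (hp : p ∈ unitBundle U G) {w w' : TM} (hw : w ∈ unitTangent G p)
    (hw' : w' ∈ unitTangent G p) : extDeriv γ p ![w, w'] = 0 := by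
  have hO := ne_zero_of_mem_unitBundle hp
  have hnhds := hG.isOpen_prod_compl.mem_nhds hO
  have hdiff : ∀ {n : ℕ} {η : Form n}, SmoothOver U η → ContDiffAt ℝ ∞ (retractForm G η) p :=
    fun hη => (hG.contDiffOn_retractForm hη).contDiffAt hnhds
  have hdγ : DifferentiableAt ℝ (extDeriv (retractForm G γ)) p :=
    ((contDiffOn_extDeriv hG.isOpen_prod_compl (hG.contDiffOn_retractForm hγ)).contDiffAt
      hnhds).differentiableAt (by simp)
  have hwedge : ∀ᶠ q in 𝓝 p, ∀ u v, extDeriv (retractForm G γ) q ![u, v] =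
      retractForm G (contactForm G) q ![u] * retractForm G α q ![v] -
        retractForm G (contactForm G) q ![v] * retractForm G α q ![u] := by
    filter_upwards [hnhds] with q hq u v
    rw [hG.extDeriv_retractForm hγ hq, compContinuousLinearMap_apply_two,
      h _ (hG.unitRetraction_mem hq) _ (hG.fderiv_unitRetraction_mem hq u) _
        (hG.fderiv_unitRetraction_mem hq v)]
    simp only [retractForm, compContinuousLinearMap_apply_one]
  have hdd : extDeriv (extDeriv (retractForm G γ)) p = 0 :=
    extDeriv_extDeriv_apply (hdiff hγ) (by simp; norm_cast)
  have hdθ : ∀ {a b : TM}, a ∈ unitTangent G p → b ∈ unitTangent G p →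
      extDeriv (retractForm G (contactForm G)) p ![a, b] =
        G p.1 (verticalPart G p a) b.1 - G p.1 (verticalPart G p b) a.1 := by
    intro a b ha hb
    rw [hG.extDeriv_retractForm hG.smoothOver_contactForm hO, compContinuousLinearMap_apply_two,
      hG.fderiv_unitRetraction_of_mem hp ha, hG.fderiv_unitRetraction_of_mem hp hb,
      unitRetraction_of_mem hp, hG.extDeriv_contactForm hp.1]
  -- This is `dθ⁰ ∧ α = 0` on the contact hyperplane, from `d² = 0` for the pulled back forms.
  have key : ∀ {a b c : TM}, a ∈ unitTangent G p → b ∈ unitTangent G p → c ∈ unitTangent G p →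
      G p.1 p.2 a.1 = 0 → G p.1 p.2 b.1 = 0 → G p.1 p.2 c.1 = 0 →
      (G p.1 (verticalPart G p a) b.1 - G p.1 (verticalPart G p b) a.1) * α p ![c] -
        (G p.1 (verticalPart G p a) c.1 - G p.1 (verticalPart G p c) a.1) * α p ![b] +
        (G p.1 (verticalPart G p b) c.1 - G p.1 (verticalPart G p c) b.1) * α p ![a] = 0 := by
    intro a b c ha hb hc ha0 hb0 hc0
    have h0 := extDeriv_mul_eq_zero_of_wedge_closed
      ((hdiff hG.smoothOver_contactForm).differentiableAt (by simp))
      ((hdiff hα).differentiableAt (by simp)) hdγ hwedge hdd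
      (a := a) (b := b) (c := c) (by rwa [hG.retractForm_apply_one hp ha])
      (by rwa [hG.retractForm_apply_one hp hb]) (by rwa [hG.retractForm_apply_one hp hc])
    rwa [hdθ ha hb, hdθ ha hc, hdθ hb hc, hG.retractForm_apply_one hp ha,
      hG.retractForm_apply_one hp hb, hG.retractForm_apply_one hp hc] at h0
  have htan := hG.mem_unitTangent_iff_inner_verticalPart hp.1
  -- For `a` purely horizontal or purely vertical, with nontrivial part `z`, choose `v ≠ 0`
  -- orthogonal to `e` and `z`. Its horizontal lift `b` and vertical lift `c` are `dθ⁰`-orthogonal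
  -- to `a`, while `dθ⁰(b, c) = -⟨v, v⟩ ≠ 0`; so `dθ⁰ ∧ α = 0` leaves only `α(a) = 0`.
  have hpure : ∀ (a : TM) (z : E3), G p.1 p.2 a.1 = 0 → G p.1 p.2 (verticalPart G p a) = 0 →
      (∀ v, G p.1 z v = 0 → G p.1 (verticalPart G p a) v = 0 ∧ G p.1 v a.1 = 0) →
      α p ![a] = 0 := by
    intro a z ha0 ha hz
    obtain ⟨v, hv0, hv, hzv⟩ := exists_ne_zero_of_two_forms (G p.1 p.2) (G p.1 z)
    obtain ⟨b, hb1, hb2⟩ := exists_fst_verticalPart G p v 0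
    obtain ⟨c, hc1, hc2⟩ := exists_fst_verticalPart G p 0 v
    have h0 := key (a := a) (b := b) (c := c) ((htan a).2 ha) ((htan b).2 (by rw [hb2, map_zero]))
      ((htan c).2 (by rw [hc2, hv])) ha0 (by rw [hb1, hv]) (by rw [hc1, map_zero])
    obtain ⟨h1, h2⟩ := hz v hzv
    simp only [hb1, hb2, hc1, hc2, h1, h2, map_zero, zero_apply, zero_mul, sub_self,
      zero_sub, zero_add] at h0
    exact (mul_eq_zero.1 h0).resolve_left (neg_ne_zero.2 (hG.pos p.1 hp.1 v hv0).ne')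
  have hαadd : ∀ a b : TM, α p ![a + b] = α p ![a] + α p ![b] := by
    intro a b
    have h1 := congrArg (fun ζ => ζ ![]) (map_add (α p).curryLeft a b)
    exact h1
  have hαsmul : ∀ (t : ℝ) (a : TM), α p ![t • a] = t * α p ![a] := by
    intro t a
    have h1 := congrArg (fun ζ => ζ ![]) (map_smul (α p).curryLeft t a)
    exact h1
  have hker : ∀ a : TM, a ∈ unitTangent G p → G p.1 p.2 a.1 = 0 → α p ![a] = 0 := by
    intro a ha ha0
    -- Horizontal plus vertical part, both again in the contact hyperplane.
    have hsplit : a = (a.1, - christoffel G p.1 a.1 p.2) + (0, verticalPart G p a) := by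
      ext i <;> simp [verticalPart]
    have hΓ0 : christoffel G p.1 0 p.2 = 0 := by
      rw [← christoffelMap_apply, map_zero]
    have hv1 : verticalPart G p (a.1, - christoffel G p.1 a.1 p.2) = 0 := by simp [verticalPart]
    have hv2 : verticalPart G p (0, verticalPart G p a) = verticalPart G p a := by
      conv_lhs => rw [verticalPart]
      simp [hΓ0]
    have e1 : α p ![(a.1, - christoffel G p.1 a.1 p.2)] = 0 :=
      hpure (a.1, - christoffel G p.1 a.1 p.2) a.1 ha0 (by rw [hv1, map_zero]) fun v hv =>
        ⟨by rw [hv1, map_zero, zero_apply], by rw [hG.symm]; exact hv⟩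
    have e2 : α p ![(0, verticalPart G p a)] = 0 :=
      hpure (0, verticalPart G p a) (verticalPart G p a) (map_zero _)
        (by rw [hv2]; exact (htan a).1 ha) fun v hv => ⟨by rw [hv2]; exact hv, map_zero _⟩
    exact (congrArg (fun z => α p ![z]) hsplit).trans (by rw [hαadd, e1, e2, add_zero])
  -- The horizontal lift of `e` is the Reeb direction, with `θ⁰(R) = 1`. Since `α` vanishes on the
  -- kernel of `θ⁰`, it equals `α(R) θ⁰`, and `θ⁰ ∧ α = 0`.
  obtain ⟨R, hR1, hR2⟩ := exists_fst_verticalPart G p p.2 0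
  have hR : R ∈ unitTangent G p := (htan R).2 (by rw [hR2, map_zero])
  have hprop : ∀ a ∈ unitTangent G p, α p ![a] = G p.1 p.2 a.1 * α p ![R] := by
    intro a ha
    have hmem : a + (-(G p.1 p.2 a.1)) • R ∈ unitTangent G p := by
      simp only [unitTangent, Set.mem_ofPred_eq] at ha hR ⊢
      rw [map_add, map_smul, ha, hR, smul_zero, add_zero]
    have h0 := hker _ hmem (by
      simp only [Prod.fst_add, Prod.smul_fst, map_add, map_smul, hR1, hp.2, smul_eq_mul]
      ring)
    rw [hαadd, hαsmul] at h0
    linarith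
  rw [h p hp w hw w' hw', hprop w hw, hprop w' hw', contactForm_apply, contactForm_apply]
  ring

end IsMetricOn

/-! ### Exactness modulo the contact form, and the Noether class. -/

theorem smoothOver_differential {U : Set E3} (hU : IsOpen U) {a : TM → ℝ} (ha : SmoothOver U a) :
    SmoothOver U (differential a) :=
  contDiffOn_of_forall_apply fun v =>
    (ContDiffOn.fderiv_of_isOpen (m := ∞) ha (isOpen_prod_univ hU) (by simp)).clm_apply
      (contDiffOn_const (c := v 0))

theorem extDeriv_sub_apply {E : Type*} [NormedAddCommGroup E] [NormedSpace ℝ E] {n : ℕ}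
    {β φ : E → E [⋀^Fin n]→L[ℝ] ℝ} {p : E} (hβ : DifferentiableAt ℝ β p)
    (hφ : DifferentiableAt ℝ φ p) :
    extDeriv (fun q => β q - φ q) p = extDeriv β p - extDeriv φ p := by
  have h : (fun q => β q - φ q) = β + (-1 : ℝ) • φ := by
    funext q
    ext v
    change β q v - φ q v = β q v + -1 * φ q v
    ring
  rw [h, extDeriv_add hβ (hφ.const_smul _), extDeriv_smul, neg_one_smul, sub_eq_add_neg]

theorem extDeriv_sub_smul_apply {E : Type*} [NormedAddCommGroup E] [NormedSpace ℝ E]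
    {β θ : E → E [⋀^Fin 1]→L[ℝ] ℝ} {a : E → ℝ} {p : E} (hβ : DifferentiableAt ℝ β p)
    (hθ : DifferentiableAt ℝ θ p) (ha : DifferentiableAt ℝ a p) (w w' : E) :
    extDeriv (fun q => β q - a q • θ q) p ![w, w'] = extDeriv β p ![w, w'] -
      a p * extDeriv θ p ![w, w'] - (fderiv ℝ a p w * θ p ![w'] - fderiv ℝ a p w' * θ p ![w]) := by
  have h := (hβ.hasFDerivAt.fun_sub (ha.hasFDerivAt.fun_smul hθ.hasFDerivAt)).fderiv
  have hv : ∀ b b' : E, fderiv ℝ (fun q => β q - a q • θ q) p b ![b'] =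
      fderiv ℝ β p b ![b'] - (a p * fderiv ℝ θ p b ![b'] + fderiv ℝ a p b * θ p ![b']) :=
    fun b b' => by rw [h]; rfl
  rw [extDeriv_apply_two, extDeriv_apply_two, extDeriv_apply_two, hv, hv]
  ring

namespace IsMetricOn

open Topology

variable {U : Set E3} {G : E3 → E3 →L[ℝ] E3 →L[ℝ] ℝ} (hG : IsMetricOn U G)
include hG

/-- Smooth functions on the slit tangent bundle can be extended to the tangent bundle without
changing them near the unit tangent bundle. -/
theorem exists_smoothOver_eventuallyEq {f : TM → ℝ} (hf : ContDiffOn ℝ ∞ f (U ×ˢ {0}ᶜ)) :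
    ∃ h : TM → ℝ, SmoothOver U h ∧ ∀ p ∈ unitBundle U G, h =ᶠ[𝓝 p] f := by
  have hN : SmoothOver U fun p => 4 * G p.1 p.2 p.2 - 1 :=
    (contDiffOn_const.mul (hG.smoothOver_inner (u := Prod.snd) (v := Prod.snd)
      contDiff_snd.contDiffOn contDiff_snd.contDiffOn)).sub contDiffOn_const
  -- A cutoff that vanishes for `|e|² ≤ 1/4` and equals `1` for `|e|² ≥ 1/2`.
  have hχ : SmoothOver U fun p => Real.smoothTransition (4 * G p.1 p.2 p.2 - 1) :=
    Real.smoothTransition.contDiff.comp_contDiffOn hN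
  have hcont : ∀ {p : TM}, p.1 ∈ U → ContinuousAt (fun p : TM => 4 * G p.1 p.2 p.2 - 1) p :=
    fun hp => (hN.differentiableAt hG.isOpen hp).continuousAt
  refine ⟨fun p => Real.smoothTransition (4 * G p.1 p.2 p.2 - 1) * f p, fun p hp => ?_,
    fun p hp => ?_⟩
  · by_cases h0 : p.2 = 0
    · have h : ∀ᶠ q in 𝓝 p, 4 * G q.1 q.2 q.2 - 1 < 0 :=
        (hcont hp.1).eventually_lt continuousAt_const (by simp [h0])
      refine ((contDiffAt_const (c := (0 : ℝ))).congr_of_eventuallyEq ?_).contDiffWithinAt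
      filter_upwards [h] with q hq
      rw [Real.smoothTransition.zero_of_nonpos hq.le, zero_mul]
    · exact ((ContDiffOn.contDiffAt hχ ((isOpen_prod_univ hG.isOpen).mem_nhds hp)).mul
        (hf.contDiffAt (hG.isOpen_prod_compl.mem_nhds ⟨hp.1, h0⟩))).contDiffWithinAt
  · have h : ∀ᶠ q in 𝓝 p, 1 < 4 * G q.1 q.2 q.2 - 1 :=
      continuousAt_const.eventually_lt (hcont hp.1) (by rw [hp.2]; norm_num)
    filter_upwards [h] with q hq
    rw [Real.smoothTransition.one_of_one_le hq.le, one_mul]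

/-- Closed `1`-forms on the unit tangent bundle over a star-shaped domain are exact. -/
theorem exists_differential_eq {y : E3} (hy : StarConvex ℝ y U) (hyU : y ∈ U) {γ : Form 1}
    (hγ : SmoothOver U γ)
    (hd : ∀ p ∈ unitBundle U G, ∀ w ∈ unitTangent G p, ∀ w' ∈ unitTangent G p,
      extDeriv γ p ![w, w'] = 0) :
    ∃ h : TM → ℝ, SmoothOver U h ∧
      ∀ p ∈ unitBundle U G, ∀ w ∈ unitTangent G p, differential h p ![w] = γ p ![w] := by
  obtain ⟨f, hf, hdf⟩ := exists_fderiv_eq_of_closed_of_ne_zero hG.isOpen hy hyU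
    (hG.contDiffOn_retractForm hγ) fun p hp => by
      ext v
      rw [vec_two_eta v, hG.extDeriv_retractForm hγ hp, compContinuousLinearMap_apply_two]
      exact hd _ (hG.unitRetraction_mem hp) _ (hG.fderiv_unitRetraction_mem hp _) _
        (hG.fderiv_unitRetraction_mem hp _)
  obtain ⟨h, hh, hhf⟩ := hG.exists_smoothOver_eventuallyEq hf
  refine ⟨h, hh, fun p hp w hw => ?_⟩
  change fderiv ℝ h p w = _
  rw [(hhf p hp).fderiv_eq, hdf p (ne_zero_of_mem_unitBundle hp), hG.retractForm_apply_one hp hw]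

/-- A `1`-form whose exterior derivative lies in the contact ideal is exact modulo the contact
form. -/
theorem exists_sub_differential_mem {y : E3} (hy : StarConvex ℝ y U) (hyU : y ∈ U) {β : Form 1}
    (hβ : SmoothOver U β) (hd : InContactIdeal₂ U G (extDeriv β)) :
    ∃ h : TM → ℝ, SmoothOver U h ∧ InEulerLagrangeSystem₁ U G (β - differential h) := by
  obtain ⟨α, a, hα, ha, heq⟩ := hd
  -- Subtracting `a θ⁰` removes the `dθ⁰` term: `d(β - a θ⁰) = θ⁰ ∧ (α + da)`.
  have hγ : SmoothOver U fun q => β q - a q • contactForm G q :=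
    ContDiffOn.sub hβ (ContDiffOn.smul ha hG.smoothOver_contactForm)
  have hα' : SmoothOver U (α + differential a) :=
    ContDiffOn.add hα (smoothOver_differential hG.isOpen ha)
  have hwedge : ∀ p ∈ unitBundle U G, ∀ w ∈ unitTangent G p, ∀ w' ∈ unitTangent G p,
      extDeriv (fun q => β q - a q • contactForm G q) p ![w, w'] =
        contactForm G p ![w] * (α + differential a) p ![w'] -
          contactForm G p ![w'] * (α + differential a) p ![w] := by
    intro p hp w hw w' hw'
    rw [extDeriv_sub_smul_apply (hβ.differentiableAt hG.isOpen hp.1)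
      (hG.smoothOver_contactForm.differentiableAt hG.isOpen hp.1)
      (ha.differentiableAt hG.isOpen hp.1), heq p hp w hw w' hw']
    change _ = contactForm G p ![w] * (α p ![w'] + fderiv ℝ a p w') -
      contactForm G p ![w'] * (α p ![w] + fderiv ℝ a p w)
    ring
  obtain ⟨h, hh, hdh⟩ := hG.exists_differential_eq hy hyU hγ fun p hp w hw w' hw' =>
    hG.extDeriv_eq_zero_of_eq_wedge hγ hα' hwedge hp hw hw'
  refine ⟨h, hh, a, ha, fun p hp w hw => ?_⟩
  change β p ![w] - differential h p ![w] = _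
  rw [hdh p hp w hw]
  exact sub_sub_cancel _ _

variable (ε : ℤˣ) (H : ℝ) {Ξ S F : E3 → E3}

/-- The Noether form of the extension of a Killing field. -/
theorem isNoetherForm {y : E3} (hy : StarConvex ℝ y U) (hyU : y ∈ U) (hΞ : IsVolumeField U G Ξ)
    (hS : ContDiffOn ℝ ∞ S U) (hK : KillingEquationOn U G S) (hF : IsPotentialVector U G ε S F) :
    IsNoetherForm U G ε H Ξ (extension S) (noetherExpr G ε H (extension S) F) := by
  refine ⟨hG.isConservationLaw ε H hS hK hF, ⟨_, hG.isCompensator ε H hΞ hS hK hF⟩,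
    fun φ hφ => ?_⟩
  obtain ⟨hφ, α, a, hα, ha, heq⟩ := hφ
  have hc := hG.smoothOver_compensator ε H hΞ.1 hS hF.1
  -- Applied to `φ_F - φ`: as `dφ_F = L_S Λ`, its exterior derivative is `L_S Λ - dφ`, in the
  -- contact ideal by assumption.
  obtain ⟨h, hh, hmem⟩ := hG.exists_sub_differential_mem hy hyU (ContDiffOn.sub hc hφ)
    ⟨α, a, hα, ha, fun p hp w hw w' hw' => by
      rw [← heq p hp w hw w' hw', Pi.sub_apply,
        hG.lieDeriv_lagrangian ε H hΞ hS hK hF hp.1]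
      exact congrArg (fun ζ => ζ ![w, w']) (extDeriv_sub_apply
        (hc.differentiableAt hG.isOpen hp.1) (hφ.differentiableAt hG.isOpen hp.1))⟩
  refine ⟨h, hh, ?_⟩
  have e : contract (extension S) (lagrangian G ε H Ξ) - φ - noetherExpr G ε H (extension S) F =
      (2 * H) • (contract (extension S) (lagrangian' G ε Ξ) + liftForm (flatForm G F)) - φ := by
    have e1 : contract (extension S) (lagrangian G ε H Ξ) =
        contract (extension S) (lagrangian₀ G ε) +
          (2 * H) • contract (extension S) (lagrangian' G ε Ξ) := rfl
    rw [e1, noetherExpr, smul_add]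
    abel
  rwa [e]

/-- The class of the Noether form does not depend on the potential vector. -/
theorem sameClass_noetherExpr {y : E3} (hy : StarConvex ℝ y U) (hyU : y ∈ U)
    (hΞ : IsVolumeField U G Ξ) (hS : ContDiffOn ℝ ∞ S U) (hK : KillingEquationOn U G S)
    {F' : E3 → E3} (hF : IsPotentialVector U G ε S F) (hF' : IsPotentialVector U G ε S F') :
    SameClass U G (noetherExpr G ε H (extension S) F) (noetherExpr G ε H (extension S) F') := by
  -- The compensator built from `F` competes with the Noether form built from `F'`, and `S ⌟ Λ -
  -- φ_F` is the expression for `F`.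
  have h := (hG.isNoetherForm ε H hy hyU hΞ hS hK hF').2.2 _ (hG.isCompensator ε H hΞ hS hK hF)
  have e1 : contract (extension S) (lagrangian G ε H Ξ) =
      contract (extension S) (lagrangian₀ G ε) +
        (2 * H) • contract (extension S) (lagrangian' G ε Ξ) := rfl
  have e2 : ∀ A B C : Form 1, A + B - (B + C) = A - C := fun A B C => by abel
  rwa [e1, smul_add, e2] at h

end IsMetricOn

/-! ### The theorem in a chart of the manifold. -/

theorem isMetricOn_coordMetric {M : Type*} [TopologicalSpace M]
    [ChartedSpace (EuclideanSpace ℝ (Fin 3)) M] [IsManifold (𝓡 3) ∞ M] (g : RiemMetric M)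
    {c : OpenPartialHomeomorph M E3} (hc : c ∈ IsManifold.maximalAtlas (𝓡 3) ∞ M) :
    IsMetricOn c.target (coordMetric g c) :=
  ⟨c.open_target, contDiffOn_coordMetric g hc, coordMetric_symm g c,
    fun _ hx _ hu => coordMetric_pos g hc hx hu⟩

theorem mainTheorem1 {M : Type*} [TopologicalSpace M] [ChartedSpace (EuclideanSpace ℝ (Fin 3)) M]
    [IsManifold (𝓡 3) ∞ M]
    (g : CMCNoether.RiemMetric M) (S : (x : M) → TangentSpace (𝓡 3) x) (hS : IsKilling g S)
    (c : OpenPartialHomeomorph M (EuclideanSpace ℝ (Fin 3)))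
    (hc : c ∈ IsManifold.maximalAtlas (𝓡 3) ∞ M)
    (hstar : ∃ y ∈ c.target, StarConvex ℝ y c.target)
    (ε : ℤˣ) (H : ℝ) (Ξ : EuclideanSpace ℝ (Fin 3) → EuclideanSpace ℝ (Fin 3))
    (hΞ : IsVolumeField c.target (coordMetric g c) Ξ) :
    -- the extension of `S` is a divergence symmetry
    IsDivergenceSymmetry c.target (coordMetric g c) ε H Ξ (extension (coordField S c)) ∧
    -- potential vectors of `S` exist
    (∃ F, IsPotentialVector c.target (coordMetric g c) ε (coordField S c) F) ∧
    -- for each of them, the Noether form is `S ⌟ Λ₀ - 2H F^♭`,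
    -- and `2H (S ⌟ Λ' + F^♭)` is a compensator
    (∀ F, IsPotentialVector c.target (coordMetric g c) ε (coordField S c) F →
      IsCompensator c.target (coordMetric g c) ε H Ξ (extension (coordField S c))
        ((2 * H) • (contract (extension (coordField S c)) (lagrangian' (coordMetric g c) ε Ξ)
          + liftForm (flatForm (coordMetric g c) F))) ∧
      IsNoetherForm c.target (coordMetric g c) ε H Ξ (extension (coordField S c))
        (noetherExpr (coordMetric g c) ε H (extension (coordField S c)) F)) ∧
    -- the class does not depend on the choice of the potential vector
    (∀ F F', IsPotentialVector c.target (coordMetric g c) ε (coordField S c) F →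
      IsPotentialVector c.target (coordMetric g c) ε (coordField S c) F' →
      SameClass c.target (coordMetric g c)
        (noetherExpr (coordMetric g c) ε H (extension (coordField S c)) F)
        (noetherExpr (coordMetric g c) ε H (extension (coordField S c)) F')) := by
  obtain ⟨y, hyU, hy⟩ := hstar
  have hG := isMetricOn_coordMetric g hc
  have hSc := contDiffOn_coordField hS.1 hc
  have hK := hS.2 c hc
  exact ⟨hG.isDivergenceSymmetry ε H hy hΞ hSc hK, hG.exists_isPotentialVector hy ε hSc hK,
    fun _ hF => ⟨hG.isCompensator ε H hΞ hSc hK hF, hG.isNoetherForm ε H hy hyU hΞ hSc hK hF⟩,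
    fun _ _ hF hF' => hG.sameClass_noetherExpr ε H hy hyU hΞ hSc hK hF hF'⟩
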